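/- Let $G$ be a finite-dimensional real Lie group with Lie algebra $\mathfrak g$ (bracket of left-invariant vector fields), and let $H,H_1,\dots,H_N:T^*G\to\mathbb R$ be smooth. Let $\lambda:T^*G\to G\times\mathfrak g^*$, $\lambda(g,p)=(g,g^{-1}p)$, be the left trivialization, and $h=H\circ\lambda^{-1}$, $h_i=H_i\circ\lambda^{-1}$. Let $\tau$ be a retraction map: a smooth diffeomorphism from an open neighbourhood of $0\in\mathfrak g$ onto an open neighbourhood of $e\in G$ with $\tau(0)=e$. Its right trivialized inverse derivative is $\mathrm d_\xi\tau^{-1}(\eta)=\mathrm D\tau^{-1}(\tau(\xi))\cdot(\eta\,\tau(\xi))$, with dual $[\mathrm d_\xi\tau^{-1}]^*$, and $\langle\operatorname{Ad}^*_g\mu,\xi\rangle=\langle\mu,\operatorname{Ad}_g\xi\rangle$. Let $T>0$, $K\ge1$, $\Delta t=T/K$, $t_k=k\Delta t$; let $W_1,\dots,W_N$ be real-valued processes on a probability space (for instance Wiener processes), and put $\Delta W^i_k=W_i(t_k)-W_i(t_{k-1})$. For a discrete curve $c_d=(g_0,\tilde g_1,\tilde\mu^1_1,\tilde\mu^2_1,g_1,\dots,\tilde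 g_K,\tilde\mu^1_K,\tilde\mu^2_K,g_K)$, with $g_k,\tilde g_k\in G$, $\tilde\mu^1_k,\tilde\mu^2_k\in\mathfrak g^*$, and with all $g_{k-1}^{-1}\tilde g_k$ and $\tilde g_k^{-1}g_k$ in the domain of $\tau^{-1}$, put $\Delta t\,\tilde\xi_k=\tau^{-1}(g_{k-1}^{-1}\tilde g_k)$, $\Delta t\,\xi_k=\tau^{-1}(\tilde g_k^{-1}g_k)$, $\bar\mu_k=\tfrac12(\tilde\mu^1_k+\tilde\mu^2_k)$, $\mathsf h_k=h+\sum_i h_i\,\Delta W^i_k/\Delta t$, and let $$\mathcal G_d(c_d)=\sum_{k=1}^{K}\Delta t\big[\langle\tilde\mu^2_k,\xi_k\rangle+\langle\tilde\mu^1_k,\tilde\xi_k\rangle-\mathsf h_k(\tilde g_k,\bar\mu_k)\big]$$ be the discrete action. The stochastic midpoint Lie group method is the system $$\tfrac1{\Delta t}\big(\operatorname{Ad}^*_{\tau(\Delta t\tilde\xi_k)}[\mathrm d_{\Delta t\tilde\xi_k}\tau^{-1}]^*\tilde\mu^1_k-[\mathrm d_{\Delta t\xi_k}\tau^{-1}]^*\tilde\mu^2_k\big)=\tilde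 g_k^{-1}\tfrac{\partial\mathsf h_k}{\partial g}(\tilde g_k,\bar\mu_k),\qquad \tilde\xi_k=\xi_k=\tfrac12\tfrac{\partial\mathsf h_k}{\partial\mu}(\tilde g_k,\bar\mu_k)\qquad(1\le k\le K),$$ $$\tfrac1{\Delta t}\big(\operatorname{Ad}^*_{\tau(\Delta t\xi_k)}[\mathrm d_{\Delta t\xi_k}\tau^{-1}]^*\tilde\mu^2_k-[\mathrm d_{\Delta t\tilde\xi_{k+1}}\tau^{-1}]^*\tilde\mu^1_{k+1}\big)=0\qquad(1\le k\le K-1).$$ Let $F_{0,T}$ be a discrete stochastic flow of this method: almost surely, $F_{0,T}$ is a smooth map from an open (possibly random) set $U\subseteq T^*G$, for instance $U=T^*G$, to $T^*G$, $(g_0,p_0)\mapsto(g_K,p_K)$, where $g_0,g_K$ are the endpoints of a solution of the method and the endpoint momenta are defined in one of the following two ways. (A) (Type I generating function.) Near each point of $U$, $$p_0=-\frac{\partial\mathcal S_d(g_0,g_K)}{\partial g_0},\qquad p_K=\frac{\partial\mathcal S_d(g_0,g_K)}{\partial g_K},\qquad \mathcal S_d(g_0,g_K)=\mathcal G_d(\bar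 c_d(g_0,g_K)),$$ where $\bar c_d(g_0,g_K)$ is a solution of the method with endpoints $g_0,g_K$ that depends smoothly on $(g_0,g_K)$ in an open subset of $G\times G$. (B) (The same momenta expressed by the curve.) Near each point of $U$, with a solution of the method that depends smoothly on $(g_0,p_0)$, $$p_0=g_0[\mathrm d_{\tau^{-1}(g_0^{-1}\tilde g_1)}\tau^{-1}]^*\tilde\mu^1_1,\qquad p_K=g_K\operatorname{Ad}^*_{\tilde g_K^{-1}g_K}[\mathrm d_{\tau^{-1}(\tilde g_K^{-1}g_K)}\tau^{-1}]^*\tilde\mu^2_K.$$ Then in both cases, almost surely, $F_{0,T}$ preserves the canonical symplectic form $\Omega_{T^*G}=\mathrm dg\wedge\mathrm dp$: $$(F_{0,T})^*\Omega_{T^*G}=\Omega_{T^*G}\quad\text{on }U,$$ and the trivialized flow $\mathcal F_{0,T}=\lambda\circ F_{0,T}\circ\lambda^{-1}$ preserves, on $\lambda(U)$, the symplectic form $$\Omega_{G\times\mathfrak g^*}(g,\mu)\big((\delta g_1,\delta\mu_1),(\delta g_2,\delta\mu_2)\big)=\langle\mu,[g^{-1}\delta g_1,g^{-1}\delta g_2]\rangle+\langle\delta\mu_2,g^{-1}\delta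 g_1\rangle-\langle\delta\mu_1,g^{-1}\delta g_2\rangle,$$ which is the trivialization of the canonical one: $\lambda^*\Omega_{G\times\mathfrak g^*}=\Omega_{T^*G}$. -/

import Mathlib

open Bundle Set Filter Topology MeasureTheory
open scoped Manifold ContDiff

noncomputable section

namespace LieMidpoint

/-! Throughout, `G` is a real Lie group modelled on the finite-dimensional normed space `E`. The Lie
algebra `𝔤 = T₁G` is, by definition of the tangent space, a copy of `E`; we write `E` for it whenever
its normed space structure is needed, and `E →L[ℝ] ℝ` for `𝔤*`. -/

/-- The cotangent bundle `T*G`, with points written `⟨g, p⟩`, `p ∈ T*_g G`. -/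
abbrev CotangentBundle (E : Type*) [NormedAddCommGroup E] [NormedSpace ℝ E]
    (G : Type*) [TopologicalSpace G] [ChartedSpace E G] : Type _ :=
  TotalSpace (E →L[ℝ] ℝ) (fun g : G => TangentSpace 𝓘(ℝ, E) g →L[ℝ] Trivial G ℝ g)

/-- The model with corners of the manifold `T*G`. -/
abbrev cotangentModel (E : Type*) [NormedAddCommGroup E] [NormedSpace ℝ E] :
    ModelWithCorners ℝ (E × (E →L[ℝ] ℝ)) (ModelProd E (E →L[ℝ] ℝ)) :=
  (𝓘(ℝ, E)).prod 𝓘(ℝ, E →L[ℝ] ℝ)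

section Group

variable {E : Type*} [NormedAddCommGroup E] [NormedSpace ℝ E]
  {G : Type*} [TopologicalSpace G] [ChartedSpace E G] [Group G] [LieGroup 𝓘(ℝ, E) ∞ G]

/-- `ξ ↦ g ξ`, the tangent map `𝔤 → T_g G` of the left translation by `g`. -/
def leftT (g : G) : E →L[ℝ] TangentSpace 𝓘(ℝ, E) g :=
  mfderiv 𝓘(ℝ, E) 𝓘(ℝ, E) (fun x : G => g * x) 1

/-- `v ↦ g⁻¹ v`, the tangent map `T_g G → 𝔤` of the left translation by `g⁻¹`. -/
def leftTInv (g : G) : TangentSpace 𝓘(ℝ, E) g →L[ℝ] E :=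
  mfderiv 𝓘(ℝ, E) 𝓘(ℝ, E) (fun x : G => g⁻¹ * x) g

/-- `ξ ↦ ξ g`, the tangent map `𝔤 → T_g G` of the right translation by `g`. -/
def rightT (g : G) : E →L[ℝ] TangentSpace 𝓘(ℝ, E) g :=
  mfderiv 𝓘(ℝ, E) 𝓘(ℝ, E) (fun x : G => x * g) 1

/-- The adjoint action `Ad_g : 𝔤 → 𝔤`, the derivative of `x ↦ g x g⁻¹` at the identity. -/
def Ad (g : G) : E →L[ℝ] E :=
  mfderiv 𝓘(ℝ, E) 𝓘(ℝ, E) (fun x : G => g * x * g⁻¹) 1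

/-- `Ad*_g μ`, defined by `⟨Ad*_g μ, ξ⟩ = ⟨μ, Ad_g ξ⟩`. -/
def coAd (g : G) (μ : E →L[ℝ] ℝ) : E →L[ℝ] ℝ := μ.comp (Ad g)

variable (G) in
/-- The Lie bracket of `𝔤 = T₁G` (the bracket of left-invariant vector fields). -/
def lieBracket (ξ η : E) : E :=
  (Bracket.bracket (show GroupLieAlgebra 𝓘(ℝ, E) G from ξ) (show GroupLieAlgebra 𝓘(ℝ, E) G from η) :
    GroupLieAlgebra 𝓘(ℝ, E) G)

/-- The left trivialization `λ : T*G → G × 𝔤*`, `λ (g, p) = (g, g⁻¹ p)`. -/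
def triv (x : CotangentBundle E G) : G × (E →L[ℝ] ℝ) :=
  (x.proj, ContinuousLinearMap.comp (x.snd : TangentSpace 𝓘(ℝ, E) x.proj →L[ℝ] ℝ) (leftT x.proj))

/-- The inverse `λ⁻¹ : G × 𝔤* → T*G`, `λ⁻¹ (g, μ) = (g, g μ)`. -/
def trivInv (y : G × (E →L[ℝ] ℝ)) : CotangentBundle E G :=
  ⟨y.1, y.2.comp (leftTInv y.1)⟩

/-! ### Symplectic forms -/

/-- The canonical coordinates `(q, p)` on `T*G` induced by the chart of `G` at `g₀`: `q` is the
coordinate of the base point, and the coordinate `p` of a covector is its pullback under the inverse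
chart. -/
def canonicalCoords (g₀ : G) (x : CotangentBundle E G) : E × (E →L[ℝ] ℝ) :=
  (extChartAt 𝓘(ℝ, E) g₀ x.proj,
    ContinuousLinearMap.comp (x.snd : TangentSpace 𝓘(ℝ, E) x.proj →L[ℝ] ℝ)
      (mfderiv 𝓘(ℝ, E) 𝓘(ℝ, E) (extChartAt 𝓘(ℝ, E) g₀).symm (extChartAt 𝓘(ℝ, E) g₀ x.proj) :
        E →L[ℝ] TangentSpace 𝓘(ℝ, E) x.proj))

/-- The differential at `x` of the canonical coordinates around `x`: its components are `dq`, `dp`. -/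
def dCoords (x : CotangentBundle E G) :
    TangentSpace (cotangentModel E) x →L[ℝ] E × (E →L[ℝ] ℝ) :=
  mfderiv (cotangentModel E) 𝓘(ℝ, E × (E →L[ℝ] ℝ)) (canonicalCoords x.proj) x

/-- The canonical symplectic form `Ω = dq ∧ dp` of `T*G` (minus the exterior derivative of the
Liouville form `p dq`). -/
def canonicalForm (x : CotangentBundle E G) (v w : TangentSpace (cotangentModel E) x) : ℝ :=
  (dCoords x w).2 (dCoords x v).1 - (dCoords x v).2 (dCoords x w).1

/-- The symplectic form of `G × 𝔤*`:
`Ω(g, μ)((δg₁, δμ₁), (δg₂, δμ₂)) = ⟨μ, [g⁻¹δg₁, g⁻¹δg₂]⟩ + ⟨δμ₂, g⁻¹δg₁⟩ - ⟨δμ₁, g⁻¹δg₂⟩`. -/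
def trivForm (y : G × (E →L[ℝ] ℝ)) (v w : TangentSpace (cotangentModel E) y) : ℝ :=
  let δg₁ : TangentSpace 𝓘(ℝ, E) y.1 := v.1
  let δg₂ : TangentSpace 𝓘(ℝ, E) y.1 := w.1
  let δμ₁ : E →L[ℝ] ℝ := v.2
  let δμ₂ : E →L[ℝ] ℝ := w.2
  let ξ₁ : E := leftTInv y.1 δg₁
  let ξ₂ : E := leftTInv y.1 δg₂
  y.2 (lieBracket G ξ₁ ξ₂) + δμ₂ ξ₁ - δμ₁ ξ₂

/-- `F` preserves the canonical symplectic form of `T*G` on the set `U`: `F^* Ω = Ω` on `U`. -/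
def IsSymplecticOn (F : CotangentBundle E G → CotangentBundle E G)
    (U : Set (CotangentBundle E G)) : Prop :=
  ∀ x ∈ U, ∀ v w : TangentSpace (cotangentModel E) x,
    canonicalForm (F x) (mfderiv (cotangentModel E) (cotangentModel E) F x v)
      (mfderiv (cotangentModel E) (cotangentModel E) F x w) = canonicalForm x v w

/-- `f` preserves the symplectic form of `G × 𝔤*` on the set `U`. -/
def IsTrivSymplecticOn (f : G × (E →L[ℝ] ℝ) → G × (E →L[ℝ] ℝ))
    (U : Set (G × (E →L[ℝ] ℝ))) : Prop :=
  ∀ y ∈ U, ∀ v w : TangentSpace (cotangentModel E) y,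
    trivForm (f y) (mfderiv (cotangentModel E) (cotangentModel E) f y v)
      (mfderiv (cotangentModel E) (cotangentModel E) f y w) = trivForm y v w

/-! ### The midpoint scheme -/

variable (E G) in
/-- A retraction map: a smooth local diffeomorphism `τ` from a neighbourhood of `0` in `𝔤` onto a
neighbourhood of the identity of `G`, with `τ 0 = 1`. Its inverse is defined on `τ.target`. -/
structure RetractionMap extends PartialDiffeomorph 𝓘(ℝ, E) 𝓘(ℝ, E) E G ∞ where
  zero_mem : (0 : E) ∈ source
  map_zero : toFun 0 = 1

/-- The right trivialized derivative `d_ξ τ⁻¹ : 𝔤 → 𝔤`, `d_ξ τ⁻¹ (η) = Dτ⁻¹(τ(ξ)) · (η τ(ξ))`. -/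
def RetractionMap.dInv (τ : RetractionMap E G) (ξ : E) : E →L[ℝ] E :=
  ContinuousLinearMap.comp
    (mfderiv 𝓘(ℝ, E) 𝓘(ℝ, E) τ.invFun (τ.toFun ξ) : TangentSpace 𝓘(ℝ, E) (τ.toFun ξ) →L[ℝ] E)
    (rightT (τ.toFun ξ))

/-- The dual map `[d_ξ τ⁻¹]^* : 𝔤* → 𝔤*`. -/
def RetractionMap.dInvDual (τ : RetractionMap E G) (ξ : E) (μ : E →L[ℝ] ℝ) : E →L[ℝ] ℝ :=
  μ.comp (τ.dInv ξ)

/-- The trivialized Hamiltonian `h = H ∘ λ⁻¹`, that is, `h(g, μ) = H(g, g μ)`. -/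
def trivHam (H : CotangentBundle E G → ℝ) (y : G × (E →L[ℝ] ℝ)) : ℝ := H (trivInv y)

/-- `g⁻¹ ∂h/∂g (g, μ) ∈ 𝔤*`. -/
def partialG (h : G × (E →L[ℝ] ℝ) → ℝ) (g : G) (μ : E →L[ℝ] ℝ) : E →L[ℝ] ℝ :=
  ContinuousLinearMap.comp
    (mfderiv 𝓘(ℝ, E) 𝓘(ℝ, ℝ) (fun a : G => h (a, μ)) g : TangentSpace 𝓘(ℝ, E) g →L[ℝ] ℝ) (leftT g)

/-- `∂h/∂μ (g, μ)`, as an element of `𝔤** = 𝔤`. -/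
def partialMu (h : G × (E →L[ℝ] ℝ) → ℝ) (g : G) (μ : E →L[ℝ] ℝ) : (E →L[ℝ] ℝ) →L[ℝ] ℝ :=
  fderiv ℝ (fun ν : E →L[ℝ] ℝ => h (g, ν)) μ

variable (E G) in
/-- A trivialized discrete curve `(g₀, g̃₁, μ̃¹₁, μ̃²₁, g₁, …, g̃_K, μ̃¹_K, μ̃²_K, g_K)`. The entries
`g̃_{k+1}, μ̃¹_{k+1}, μ̃²_{k+1}` of the interval `[t_k, t_{k+1}]` are `gt k`, `mu1 k`, `mu2 k`,
for `k = 0, …, K - 1`. -/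
structure DiscreteCurve (K : ℕ) where
  g : Fin (K + 1) → G
  gt : Fin K → G
  mu1 : Fin K → E →L[ℝ] ℝ
  mu2 : Fin K → E →L[ℝ] ℝ

variable (E G) in
/-- The data of the scheme along one sample path: the Hamiltonians `H`, `H₁, …, H_N` on `T*G`, the
retraction map, the time step, and the increments `dW k i = W_i(t_{k+1}) - W_i(t_k)`. -/
structure SchemeData (K N : ℕ) where
  H : CotangentBundle E G → ℝ
  Hs : Fin N → CotangentBundle E G → ℝ
  τ : RetractionMap E G
  dt : ℝ
  dW : Fin K → Fin N → ℝ

/-- The data of the scheme with `K` steps on `[0, T]` along the sample `s`, for the driving processes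
`W₁, …, W_N`: the time step is `Δt = T / K`, and `t_k = k Δt`. -/
def schemeAt (H : CotangentBundle E G → ℝ) {N : ℕ} (Hs : Fin N → CotangentBundle E G → ℝ)
    (τ : RetractionMap E G) (T : ℝ) (K : ℕ) {Ω : Type*} (W : Fin N → ℝ → Ω → ℝ) (s : Ω) :
    SchemeData E G K N where
  H := H
  Hs := Hs
  τ := τ
  dt := T / K
  dW k i := W i (((k : ℕ) + 1 : ℝ) * (T / K)) s - W i (((k : ℕ) : ℝ) * (T / K)) s

namespace SchemeData

variable {K N : ℕ} (D : SchemeData E G K N) (c : DiscreteCurve E G K)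

/-- The discrete increments lie in the domain of `τ⁻¹`, so that the scheme makes sense along `c`. -/
def Admissible : Prop :=
  ∀ k : Fin K, (c.g k.castSucc)⁻¹ * c.gt k ∈ D.τ.target ∧ (c.gt k)⁻¹ * c.g k.succ ∈ D.τ.target

/-- `ξ̃`, with `Δt ξ̃_{k+1} = τ⁻¹(g_k⁻¹ g̃_{k+1})`. -/
def xiTilde (k : Fin K) : E := D.dt⁻¹ • D.τ.invFun ((c.g k.castSucc)⁻¹ * c.gt k)

/-- `ξ`, with `Δt ξ_{k+1} = τ⁻¹(g̃_{k+1}⁻¹ g_{k+1})`. -/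
def xi (k : Fin K) : E := D.dt⁻¹ • D.τ.invFun ((c.gt k)⁻¹ * c.g k.succ)

/-- The average `(μ̃¹ + μ̃²) / 2`. -/
def muMid (k : Fin K) : E →L[ℝ] ℝ := (1 / 2 : ℝ) • (c.mu1 k + c.mu2 k)

/-- The trivialized discrete action functional `𝒢_d`. -/
def action : ℝ :=
  ∑ k : Fin K, D.dt *
    (c.mu2 k (D.xi c k) + c.mu1 k (D.xiTilde c k)
      - trivHam D.H (c.gt k, muMid c k)
      - ∑ i : Fin N, trivHam (D.Hs i) (c.gt k, muMid c k) * (D.dW k i / D.dt))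

/-- `½ ∂h/∂μ + ½ ∑ᵢ ∂hᵢ/∂μ ΔWⁱ/Δt` at `(g̃, (μ̃¹ + μ̃²)/2)`. -/
def velocity (k : Fin K) : (E →L[ℝ] ℝ) →L[ℝ] ℝ :=
  (1 / 2 : ℝ) • partialMu (trivHam D.H) (c.gt k) (muMid c k)
    + (1 / 2 : ℝ) • ∑ i : Fin N,
        (D.dW k i / D.dt) • partialMu (trivHam (D.Hs i)) (c.gt k) (muMid c k)

/-- The stochastic midpoint Lie group method: `c` solves its four families of equations. -/
structure Solves : Prop where
  admissible : D.Admissible c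
  eq_gt : ∀ k : Fin K,
    D.dt⁻¹ •
      (coAd (D.τ.toFun (D.dt • D.xiTilde c k)) (D.τ.dInvDual (D.dt • D.xiTilde c k) (c.mu1 k))
        - D.τ.dInvDual (D.dt • D.xi c k) (c.mu2 k))
      = partialG (trivHam D.H) (c.gt k) (muMid c k)
        + ∑ i : Fin N, (D.dW k i / D.dt) • partialG (trivHam (D.Hs i)) (c.gt k) (muMid c k)
  eq_g : ∀ (k : ℕ) (hk : k + 1 < K),
    D.dt⁻¹ •
      (coAd (D.τ.toFun (D.dt • D.xi c ⟨k, by omega⟩))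
          (D.τ.dInvDual (D.dt • D.xi c ⟨k, by omega⟩) (c.mu2 ⟨k, by omega⟩))
        - D.τ.dInvDual (D.dt • D.xiTilde c ⟨k + 1, hk⟩) (c.mu1 ⟨k + 1, hk⟩)) = 0
  eq_mu1 : ∀ (k : Fin K) (ν : E →L[ℝ] ℝ), ν (D.xiTilde c k) = D.velocity c k ν
  eq_mu2 : ∀ (k : Fin K) (ν : E →L[ℝ] ℝ), ν (D.xi c k) = D.velocity c k ν

end SchemeData

/-- A family of discrete curves depends smoothly on its parameter on the set `V`: all its entries
do. -/
structure SmoothFamilyOn {F : Type*} [NormedAddCommGroup F] [NormedSpace ℝ F]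
    {B : Type*} [TopologicalSpace B] (I : ModelWithCorners ℝ F B)
    {M : Type*} [TopologicalSpace M] [ChartedSpace B M] {K : ℕ}
    (c : M → DiscreteCurve E G K) (V : Set M) : Prop where
  g : ∀ k, ContMDiffOn I 𝓘(ℝ, E) ∞ (fun z => (c z).g k) V
  gt : ∀ k, ContMDiffOn I 𝓘(ℝ, E) ∞ (fun z => (c z).gt k) V
  mu1 : ∀ k, ContMDiffOn I 𝓘(ℝ, E →L[ℝ] ℝ) ∞ (fun z => (c z).mu1 k) V
  mu2 : ∀ k, ContMDiffOn I 𝓘(ℝ, E →L[ℝ] ℝ) ∞ (fun z => (c z).mu2 k) V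

namespace SchemeData

variable {K N : ℕ} (D : SchemeData E G K N)

/-- `c` is a smooth branch, on the open set `V ⊆ G × G`, of solutions of the scheme (critical
discrete curves) with prescribed endpoints `(g₀, g_K) ∈ V`. -/
structure IsCriticalBranch (c : G × G → DiscreteCurve E G K) (V : Set (G × G)) : Prop where
  isOpen : IsOpen V
  smooth : SmoothFamilyOn ((𝓘(ℝ, E)).prod 𝓘(ℝ, E)) c V
  solves : ∀ z ∈ V, D.Solves (c z)
  left : ∀ z ∈ V, (c z).g 0 = z.1
  right : ∀ z ∈ V, (c z).g (Fin.last K) = z.2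

/-- The type I generating function `𝒮_d(g₀, g_K)`: the value of the action on the critical curve
with endpoints `(g₀, g_K)`. -/
def genFun (c : G × G → DiscreteCurve E G K) (z : G × G) : ℝ := D.action (c z)

/-- The relation `(g₀, p₀) ↦ (g_K, p_K)` generated by a function `S(g₀, g_K)`:
`p₀ = - ∂S/∂g₀` and `p_K = ∂S/∂g_K`. -/
def Generates (S : G × G → ℝ) (x y : CotangentBundle E G) : Prop :=
  (x.snd : TangentSpace 𝓘(ℝ, E) x.proj →L[ℝ] ℝ)
      = -(mfderiv 𝓘(ℝ, E) 𝓘(ℝ, ℝ) (fun a : G => S (a, y.proj)) x.proj :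
          TangentSpace 𝓘(ℝ, E) x.proj →L[ℝ] ℝ) ∧
  (y.snd : TangentSpace 𝓘(ℝ, E) y.proj →L[ℝ] ℝ)
      = (mfderiv 𝓘(ℝ, E) 𝓘(ℝ, ℝ) (fun b : G => S (x.proj, b)) y.proj :
          TangentSpace 𝓘(ℝ, E) y.proj →L[ℝ] ℝ)

/-- `F` is, on the open set `U`, the discrete flow `(g₀, p₀) ↦ (g_K, p_K)` of the midpoint scheme,
the endpoint momenta being given by the type I generating function `𝒮_d` (of a smooth branch of
critical curves, which may depend on the region of `T*G` considered). -/
structure IsTypeIFlow (U : Set (CotangentBundle E G))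
    (F : CotangentBundle E G → CotangentBundle E G) : Prop where
  isOpen : IsOpen U
  smooth : ContMDiffOn (cotangentModel E) (cotangentModel E) ∞ F U
  generated : ∀ x₀ ∈ U, ∃ (c : G × G → DiscreteCurve E G K) (V : Set (G × G)),
    D.IsCriticalBranch c V ∧
      ∀ᶠ x in 𝓝 x₀, (x.proj, (F x).proj) ∈ V ∧ Generates (D.genFun c) x (F x)

/-- `F` is, on the open set `U`, the discrete flow `(g₀, p₀) ↦ (g_K, p_K)` of the midpoint scheme,
the endpoint momenta being expressed by the entries of the discrete curve,
`p₀ = g₀ [d_{τ⁻¹(g₀⁻¹ g̃₁)} τ⁻¹]^* μ̃¹₁` and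
`p_K = g_K Ad*_{g̃_K⁻¹ g_K} [d_{τ⁻¹(g̃_K⁻¹ g_K)} τ⁻¹]^* μ̃²_K`.
No generating function on `G × G` needs to exist here. -/
structure IsMidpointFlow [NeZero K] (U : Set (CotangentBundle E G))
    (F : CotangentBundle E G → CotangentBundle E G) : Prop where
  isOpen : IsOpen U
  smooth : ContMDiffOn (cotangentModel E) (cotangentModel E) ∞ F U
  generated : ∀ x₀ ∈ U,
    ∃ (c : CotangentBundle E G → DiscreteCurve E G K) (V : Set (CotangentBundle E G)),
      IsOpen V ∧ x₀ ∈ V ∧ SmoothFamilyOn (cotangentModel E) c V ∧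
      ∀ x ∈ V, D.Solves (c x) ∧
        x = trivInv ((c x).g 0,
          D.τ.dInvDual (D.τ.invFun (((c x).g 0)⁻¹ * (c x).gt 0)) ((c x).mu1 0)) ∧
        F x = trivInv ((c x).g (Fin.last K),
          coAd (((c x).gt (Fin.rev 0))⁻¹ * (c x).g (Fin.last K))
            (D.τ.dInvDual (D.τ.invFun (((c x).gt (Fin.rev 0))⁻¹ * (c x).g (Fin.last K)))
              ((c x).mu2 (Fin.rev 0))))

end SchemeData

end Group

end LieMidpoint

end

noncomputable section

namespace LieMidpoint

set_option linter.unusedSectionVars false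

variable {E : Type*} [NormedAddCommGroup E] [NormedSpace ℝ E]
  {G : Type*} [TopologicalSpace G] [ChartedSpace E G] [Group G] [LieGroup 𝓘(ℝ, E) ∞ G]
  {Z : Type*} [NormedAddCommGroup Z] [NormedSpace ℝ Z]

/-! The canonical form is `-dθ` for the Liouville form `θ = p dg`, so `F` is symplectic as soon as
`F^*θ - θ` is exact. This criterion is `canonicalForm_mfderiv_of_exact`, with its variant in a
chart; it rests on the symmetry of second derivatives, through `canonicalForm_pullback` and
`canonicalForm_pullback_eq`.

For both kinds of flow the primitive is the discrete action along the solution. In case (A) it is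
`𝒮_d(g₀, g_K(x))`, whose differential is `p_K dg_K - p₀ dg₀` by the chain rule and the definition of
the momenta; of the scheme only admissibility is needed, to make `𝒮_d` smooth. In case (B) it is `x
↦ 𝒢_d(c(x))`, a function on `T*G` itself. Its differential is computed in `fderiv_action`: within
one step the equations cancel the variations of `g̃`, `μ̃¹`, `μ̃²` (`fderiv_action_summand`), the
matching condition at interior nodes makes the rest telescope, and the two surviving boundary terms
are `p_K dg_K` and `-p₀ dg₀`.

For the trivialized statement, `θ = ⟨μ, ω⟩` with `ω` the left Maurer-Cartan form. The structure
equation `fderiv_maurerCartan` turns `-d⟨μ, ω⟩` into `trivForm`, which gives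
`trivForm_mfderiv_triv`; conjugation by `λ` then transports symplecticity. Everything is done for
one fixed sample path. -/

/-! ### Canonical coordinates and the smooth structure of `T*G`. -/

/-- A chart of a bundle of linear maps conjugates by the trivializations of source and target. For
the tangent bundle the inverse trivialization is the derivative of the inverse chart, and the target
is trivial, so what remains is the pullback defining `p`. -/
lemma extChartAt_eq_canonicalCoords (y x : CotangentBundle E G)
    (hx : x.proj ∈ (chartAt E y.proj).source) :
    extChartAt (cotangentModel E) y x = canonicalCoords y.proj x := by
  have h := hom_chart (HB := E) (F₁ := E) (F₂ := ℝ) (E₁ := (TangentSpace 𝓘(ℝ, E) : G → Type _))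
      (E₂ := Trivial G ℝ) y x
  have hy := TangentBundle.symmL_trivializationAt (I := 𝓘(ℝ, E)) hx
  have h2 : extChartAt (cotangentModel E) y x
      = (chartAt E y.proj x.proj, ContinuousLinearMap.inCoordinates E
      (TangentSpace 𝓘(ℝ, E) : G → Type _) ℝ (Trivial G ℝ) y.proj x.proj y.proj x.proj x.snd) := h
  rw [h2]
  ext1
  · simp [canonicalCoords]
  · ext v
    simp only [canonicalCoords, ContinuousLinearMap.inCoordinates]
    rw [hy]
    simp [Trivial.trivialization]
    rfl

lemma contMDiffAt_canonicalCoords {g₀ : G} {x : CotangentBundle E G}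
    (hx : x.proj ∈ (chartAt E g₀).source) :
    ContMDiffAt (cotangentModel E) 𝓘(ℝ, E × (E →L[ℝ] ℝ)) ∞ (canonicalCoords g₀) x := by
  -- The chart of `T*G` at a point depends only on the base point, so the zero covector serves to
  -- name it.
  have h : ContMDiffAt (cotangentModel E) 𝓘(ℝ, E × (E →L[ℝ] ℝ)) ∞
      (extChartAt (cotangentModel E) (⟨g₀, 0⟩ : CotangentBundle E G)) x := by
    apply contMDiffAt_extChartAt'
    simp [FiberBundle.chartedSpace_chartAt, hx]
  refine h.congr_of_eventuallyEq ?_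
  have : ∀ᶠ y : CotangentBundle E G in 𝓝 x, y.proj ∈ (chartAt E g₀).source :=
    (FiberBundle.continuous_proj _ _).continuousAt.eventually_mem
        ((chartAt E g₀).open_source.mem_nhds hx)
  filter_upwards [this] with y hy
  exact (extChartAt_eq_canonicalCoords ⟨g₀, 0⟩ y hy).symm

lemma contMDiffAt_cotangent {F : Type*} [NormedAddCommGroup F] [NormedSpace ℝ F]
    {B : Type*} [TopologicalSpace B] {I : ModelWithCorners ℝ F B}
    {M : Type*} [TopologicalSpace M] [ChartedSpace B M] {f : M → CotangentBundle E G} {m : M}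
    (h1 : ContMDiffAt I 𝓘(ℝ, E) ∞ (fun z => (f z).proj) m)
    (h2 : ContMDiffAt I 𝓘(ℝ, E →L[ℝ] ℝ) ∞ (fun z => (canonicalCoords (f m).proj (f z)).2) m) :
    ContMDiffAt I (cotangentModel E) ∞ f m := by
  rw [contMDiffAt_hom_bundle]
  refine ⟨h1, h2.congr_of_eventuallyEq ?_⟩
  have : ∀ᶠ z in 𝓝 m, (f z).proj ∈ (chartAt E (f m).proj).source :=
    h1.continuousAt.eventually_mem ((chartAt E (f m).proj).open_source.mem_nhds
        (mem_chart_source _ _))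
  filter_upwards [this] with z hz
  rw [← extChartAt_eq_canonicalCoords (f m) (f z) hz]
  have h := hom_chart (HB := E) (F₁ := E) (F₂ := ℝ) (E₁ := (TangentSpace 𝓘(ℝ, E) : G → Type _))
      (E₂ := Trivial G ℝ) (f m) (f z)
  exact (congrArg Prod.snd h).symm

lemma contMDiff_cotangent_proj :
    ContMDiff (cotangentModel E) 𝓘(ℝ, E) ∞ (fun x : CotangentBundle E G => x.proj) :=
  contMDiff_proj _

lemma contMDiffAt_fderiv {E' : Type*} [NormedAddCommGroup E'] [NormedSpace ℝ E'] {g₁ : G}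
    {f : G → E → E'} {u : G → E}
    (hf : ContMDiffAt ((𝓘(ℝ, E)).prod 𝓘(ℝ, E)) 𝓘(ℝ, E') ∞ (Function.uncurry f) (g₁, u g₁))
    (hu : ContMDiffAt 𝓘(ℝ, E) 𝓘(ℝ, E) ∞ u g₁) :
    ContMDiffAt 𝓘(ℝ, E) 𝓘(ℝ, E →L[ℝ] E') ∞ (fun g => fderiv ℝ (f g) (u g)) g₁ := by
  have := ContMDiffAt.mfderiv f u hf hu (m := ∞) (by simp)
  simpa [inTangentCoordinates_model_space, mfderiv_eq_fderiv] using this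

/-! ### Translations, and smoothness of the left trivialization and its inverse. -/

lemma mdifferentiableAt_mul_left (a b : G) :
    MDifferentiableAt 𝓘(ℝ, E) 𝓘(ℝ, E) (fun x : G => a * x) b :=
  (contMDiff_mul_left (I := 𝓘(ℝ, E)) (n := ∞)).mdifferentiableAt (by simp)

lemma mdifferentiableAt_mul_right (a b : G) :
    MDifferentiableAt 𝓘(ℝ, E) 𝓘(ℝ, E) (fun x : G => x * a) b :=
  (contMDiff_mul_right (I := 𝓘(ℝ, E)) (n := ∞)).mdifferentiableAt (by simp)

lemma leftTInv_leftT (g : G) (ξ : E) : leftTInv g (leftT (E := E) g ξ) = ξ := by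
  have h := mfderiv_comp_apply_of_eq (I := 𝓘(ℝ, E)) (I' := 𝓘(ℝ, E)) (I'' := 𝓘(ℝ, E)) (x := (1 : G))
      (y := g)
    (f := fun x : G => g * x) (g := fun x : G => g⁻¹ * x)
    (mdifferentiableAt_mul_left _ _) (mdifferentiableAt_mul_left _ _) (by simp) ξ
  have h2 : (fun x : G => g⁻¹ * x) ∘ (fun x : G => g * x) = id := by ext; simp
  rw [h2, mfderiv_id] at h
  exact h.symm

lemma leftT_leftTInv (g : G) (v : TangentSpace 𝓘(ℝ, E) g) : leftT g (leftTInv g v) = v := by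
  have h := mfderiv_comp_apply_of_eq (I := 𝓘(ℝ, E)) (I' := 𝓘(ℝ, E)) (I'' := 𝓘(ℝ, E)) (x := (g : G))
      (y := 1)
    (f := fun x : G => g⁻¹ * x) (g := fun x : G => g * x)
    (mdifferentiableAt_mul_left _ _) (mdifferentiableAt_mul_left _ _) (by simp) v
  have h2 : (fun x : G => g * x) ∘ (fun x : G => g⁻¹ * x) = id := by ext; simp
  rw [h2, mfderiv_id] at h
  exact h.symm

lemma triv_trivInv (y : G × (E →L[ℝ] ℝ)) : triv (trivInv y) = y := by
  refine Prod.ext rfl (ContinuousLinearMap.ext fun ξ => ?_)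
  exact congrArg y.2 (leftTInv_leftT y.1 ξ)

lemma contMDiffAt_extChartAt_symm' {F : Type*} [NormedAddCommGroup F] [NormedSpace ℝ F]
    {B : Type*} [TopologicalSpace B] {I : ModelWithCorners ℝ F B} [I.Boundaryless]
    {M : Type*} [TopologicalSpace M] [ChartedSpace B M] [IsManifold I ∞ M] {x₀ x : M}
    (hx : x ∈ (chartAt B x₀).source) :
    ContMDiffAt 𝓘(ℝ, F) I ∞ (extChartAt I x₀).symm (extChartAt I x₀ x) := by
  have hx' : x ∈ (extChartAt I x₀).source := by rwa [extChartAt_source]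
  exact (contMDiffOn_extChartAt_symm x₀).contMDiffAt
    ((isOpen_extChartAt_target x₀).mem_nhds ((extChartAt I x₀).map_source hx'))

lemma mfderiv_extChartAt_symm_apply {F : Type*} [NormedAddCommGroup F] [NormedSpace ℝ F]
    {B : Type*} [TopologicalSpace B] {I : ModelWithCorners ℝ F B} [I.Boundaryless]
    {M : Type*} [TopologicalSpace M] [ChartedSpace B M] [IsManifold I ∞ M] {x₀ x : M}
    (hx : x ∈ (chartAt B x₀).source) (v : TangentSpace I x) :
    mfderiv 𝓘(ℝ, F) I (extChartAt I x₀).symm (extChartAt I x₀ x)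
        (mfderiv I 𝓘(ℝ, F) (extChartAt I x₀) x v) = v := by
  have hx' : x ∈ (extChartAt I x₀).source := by rwa [extChartAt_source]
  have : IsManifold I 1 M := IsManifold.of_le (n := ∞) (by simp)
  have h := mfderiv_comp_apply_of_eq (x := x) (y := extChartAt I x₀ x) (f := extChartAt I x₀)
      (g := (extChartAt I x₀).symm)
    ((contMDiffAt_extChartAt_symm' hx).mdifferentiableAt (by simp))
        (mdifferentiableAt_extChartAt hx) rfl v
  rw [← h]
  have h2 : (extChartAt I x₀).symm ∘ (extChartAt I x₀) =ᶠ[𝓝 x] id := by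
    filter_upwards [(isOpen_extChartAt_source (I := I) x₀).mem_nhds hx'] with y hy
    exact (extChartAt I x₀).left_inv hy
  rw [h2.mfderiv_eq, mfderiv_id]
  rfl

/-- The derivative of the left translation by `g`, read in the charts at `1` and `g₀`. -/
lemma fderiv_leftT (g₀ g : G) (hg : g ∈ (chartAt E g₀).source) (ξ : E) :
    fderiv ℝ (fun y : E => extChartAt 𝓘(ℝ, E) g₀ (g * (extChartAt 𝓘(ℝ, E) (1 : G)).symm y))
        (extChartAt 𝓘(ℝ, E) (1 : G) 1) ξ
      = mfderiv 𝓘(ℝ, E) 𝓘(ℝ, E) (extChartAt 𝓘(ℝ, E) g₀) g (leftT g ξ) := by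
  have h1 := mfderiv_comp_apply_of_eq (x := (1 : G)) (y := g) (I := 𝓘(ℝ, E)) (I' := 𝓘(ℝ, E))
      (I'' := 𝓘(ℝ, E)) (f := fun x : G => g * x)
    (g := extChartAt 𝓘(ℝ, E) g₀) (mdifferentiableAt_extChartAt hg) (mdifferentiableAt_mul_left _ _)
        (by simp) ξ
  have hs := contMDiffAt_extChartAt_symm' (I := 𝓘(ℝ, E)) (mem_chart_source E (1 : G))
  have h2 := mfderiv_comp_apply_of_eq (I := 𝓘(ℝ, E)) (I' := 𝓘(ℝ, E)) (I'' := 𝓘(ℝ, E))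
      (x := extChartAt 𝓘(ℝ, E) (1 : G) 1) (y := (1 : G))
    (g := (extChartAt 𝓘(ℝ, E) g₀ : G → E) ∘ (fun x : G => g * x))
        (f := (extChartAt 𝓘(ℝ, E) (1 : G)).symm)
    ((mdifferentiableAt_extChartAt (by simpa using hg)).comp (1 : G)
        (mdifferentiableAt_mul_left g 1))
    (hs.mdifferentiableAt (by simp)) (by simp) ξ
  have h3 := mfderiv_extChartAt_symm_apply (I := 𝓘(ℝ, E)) (mem_chart_source E (1 : G)) ξ
  rw [mfderiv_extChartAt_self] at h3
  rw [← mfderiv_eq_fderiv]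
  refine h2.trans ?_
  refine Eq.trans ?_ h1
  exact congrArg _ h3

/-- The derivative of the left translation by `g⁻¹`, read in the charts at `g₀` and `1`. -/
lemma fderiv_leftTInv (g₀ g : G) (hg : g ∈ (chartAt E g₀).source) (u : E) :
    fderiv ℝ (fun y : E => extChartAt 𝓘(ℝ, E) (1 : G) (g⁻¹ * (extChartAt 𝓘(ℝ, E) g₀).symm y))
        (extChartAt 𝓘(ℝ, E) g₀ g) u
      = leftTInv g (mfderiv 𝓘(ℝ, E) 𝓘(ℝ, E) (extChartAt 𝓘(ℝ, E) g₀).symm (extChartAt 𝓘(ℝ, E) g₀ g)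
          u) := by
  have hg' : g ∈ (extChartAt 𝓘(ℝ, E) g₀).source := by rwa [extChartAt_source]
  have h1 := mfderiv_comp_apply_of_eq (x := g) (y := (1 : G)) (I := 𝓘(ℝ, E)) (I' := 𝓘(ℝ, E))
      (I'' := 𝓘(ℝ, E)) (f := fun x : G => g⁻¹ * x)
    (g := extChartAt 𝓘(ℝ, E) (1 : G)) (mdifferentiableAt_extChartAt (mem_chart_source E (1 : G)))
        (mdifferentiableAt_mul_left _ _) (by simp)
  have hs := contMDiffAt_extChartAt_symm' (I := 𝓘(ℝ, E)) hg
  have h2 := mfderiv_comp_apply_of_eq (I := 𝓘(ℝ, E)) (I' := 𝓘(ℝ, E)) (I'' := 𝓘(ℝ, E))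
      (x := extChartAt 𝓘(ℝ, E) g₀ g) (y := g)
    (g := (extChartAt 𝓘(ℝ, E) (1 : G) : G → E) ∘ (fun x : G => g⁻¹ * x))
        (f := (extChartAt 𝓘(ℝ, E) g₀).symm)
    ((mdifferentiableAt_extChartAt (by simp)).comp g (mdifferentiableAt_mul_left g⁻¹ g))
    (hs.mdifferentiableAt (by simp)) ((extChartAt 𝓘(ℝ, E) g₀).left_inv hg') u
  rw [← mfderiv_eq_fderiv]
  refine h2.trans ((h1 _).trans ?_)
  rw [mfderiv_extChartAt_self]
  rfl

/-- Read in charts, the tangent map of a translation is a partial derivative of the jointly smooth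
multiplication, hence smooth in `g` with values in the fixed space `E →L[ℝ] E`. -/
lemma contMDiffAt_leftT_coord {g₀ g : G} (hg : g ∈ (chartAt E g₀).source) :
    ContMDiffAt 𝓘(ℝ, E) 𝓘(ℝ, E →L[ℝ] E) ∞ (fun g : G =>
      fderiv ℝ (fun y : E => extChartAt 𝓘(ℝ, E) g₀ (g * (extChartAt 𝓘(ℝ, E) (1 : G)).symm y))
          (extChartAt 𝓘(ℝ, E) (1 : G) 1)) g := by
  apply contMDiffAt_fderiv (f := fun g y => extChartAt 𝓘(ℝ, E) g₀
      (g * (extChartAt 𝓘(ℝ, E) (1 : G)).symm y)) _ contMDiffAt_const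
  have h1 : ContMDiffAt 𝓘(ℝ, E) 𝓘(ℝ, E) ∞ (extChartAt 𝓘(ℝ, E) g₀)
      (g * (extChartAt 𝓘(ℝ, E) (1 : G)).symm (extChartAt 𝓘(ℝ, E) (1 : G) 1)) := by
    apply contMDiffAt_extChartAt'
    simpa using hg
  refine h1.comp (g, extChartAt 𝓘(ℝ, E) (1 : G) 1) (f := fun z : G × E =>
      z.1 * (extChartAt 𝓘(ℝ, E) (1 : G)).symm z.2) ?_
  refine contMDiffAt_fst.mul ?_
  exact ContMDiffAt.comp (g, extChartAt 𝓘(ℝ, E) (1 : G) 1) (f := Prod.snd)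
      (contMDiffAt_extChartAt_symm' (I := 𝓘(ℝ, E)) (mem_chart_source E (1 : G))) contMDiffAt_snd

lemma contMDiffAt_leftTInv_coord {g₀ g : G} (hg : g ∈ (chartAt E g₀).source) :
    ContMDiffAt 𝓘(ℝ, E) 𝓘(ℝ, E →L[ℝ] E) ∞ (fun g : G =>
      fderiv ℝ (fun y : E => extChartAt 𝓘(ℝ, E) (1 : G) (g⁻¹ * (extChartAt 𝓘(ℝ, E) g₀).symm y))
          (extChartAt 𝓘(ℝ, E) g₀ g)) g := by
  have hg' : g ∈ (extChartAt 𝓘(ℝ, E) g₀).source := by rwa [extChartAt_source]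
  apply contMDiffAt_fderiv (f := fun g y => extChartAt 𝓘(ℝ, E) (1 : G)
      (g⁻¹ * (extChartAt 𝓘(ℝ, E) g₀).symm y)) _ (contMDiffAt_extChartAt' hg)
  have h1 : ContMDiffAt 𝓘(ℝ, E) 𝓘(ℝ, E) ∞ (extChartAt 𝓘(ℝ, E) (1 : G))
      (g⁻¹ * (extChartAt 𝓘(ℝ, E) g₀).symm (extChartAt 𝓘(ℝ, E) g₀ g)) := by
    apply contMDiffAt_extChartAt'
    rw [(extChartAt 𝓘(ℝ, E) g₀).left_inv hg']
    simp
  refine h1.comp (g, extChartAt 𝓘(ℝ, E) g₀ g) (f := fun z : G × E =>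
      z.1⁻¹ * (extChartAt 𝓘(ℝ, E) g₀).symm z.2) ?_
  refine contMDiffAt_fst.inv.mul ?_
  exact ContMDiffAt.comp (g, extChartAt 𝓘(ℝ, E) g₀ g) (f := Prod.snd)
      (contMDiffAt_extChartAt_symm' (I := 𝓘(ℝ, E)) hg) contMDiffAt_snd

lemma contMDiff_triv : ContMDiff (cotangentModel E) (cotangentModel E) ∞
    (triv : CotangentBundle E G → _) := by
  intro x₀
  refine (contMDiff_cotangent_proj x₀).prodMk ?_
  have hs := mem_chart_source E x₀.proj
  -- With `φ` the chart at the base point of `x₀`, the covector factors as `p ∘ L_g = (p ∘ dφ⁻¹) ∘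
  -- (dφ ∘ L_g)`, a composition of two smooth families of linear maps.
  have h := (contDiff_snd.contMDiff.contMDiffAt.comp x₀ (contMDiffAt_canonicalCoords hs)).clm_comp
      ((contMDiffAt_leftT_coord hs).comp x₀ (contMDiff_cotangent_proj x₀))
  refine h.congr_of_eventuallyEq ?_
  have : ∀ᶠ y : CotangentBundle E G in 𝓝 x₀, y.proj ∈ (chartAt E x₀.proj).source :=
    (FiberBundle.continuous_proj _ _).continuousAt.eventually_mem
        ((chartAt E x₀.proj).open_source.mem_nhds hs)
  filter_upwards [this] with x hx
  ext ξ
  refine congrArg x.snd ?_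
  simp only [Function.comp_apply]
  have h1 := fderiv_leftT _ _ hx ξ
  have h2 := mfderiv_extChartAt_symm_apply (I := 𝓘(ℝ, E)) hx (leftT x.proj ξ)
  exact h2.symm.trans (congrArg _ h1.symm)

lemma contMDiff_trivInv : ContMDiff (cotangentModel E) (cotangentModel E) ∞
    (trivInv : G × (E →L[ℝ] ℝ) → _) := by
  intro y₀
  apply contMDiffAt_cotangent
  · exact contMDiffAt_fst
  have hs := mem_chart_source E y₀.1
  have h := (contMDiffAt_snd (p := y₀)).clm_comp ((contMDiffAt_leftTInv_coord hs).comp y₀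
      contMDiffAt_fst)
  refine h.congr_of_eventuallyEq ?_
  have : ∀ᶠ y : G × (E →L[ℝ] ℝ) in 𝓝 y₀, y.1 ∈ (chartAt E y₀.1).source :=
    continuous_fst.continuousAt.eventually_mem ((chartAt E y₀.1).open_source.mem_nhds hs)
  filter_upwards [this] with y hy
  ext u
  exact (congrArg y.2 (fderiv_leftTInv _ _ hy u)).symm

/-! ### The Liouville form and the exactness criterion. -/

/-- The function is the Liouville form `p dq` on a constant field. The first term, with the second
derivative of `q`, disappears on antisymmetrization; the second yields `dq ∧ dp`. -/
lemma hasFDerivAt_pairing {p : Z → E →L[ℝ] ℝ} {q : Z → E} {z : Z}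
    (hp : ContDiffAt ℝ ∞ p z) (hq : ContDiffAt ℝ ∞ q z) (v : Z) :
    HasFDerivAt (fun z => p z (fderiv ℝ q z v))
      ((p z).comp ((ContinuousLinearMap.apply ℝ E v).comp (fderiv ℝ (fderiv ℝ q) z))
        + (fderiv ℝ p z).flip (fderiv ℝ q z v)) z := by
  have h1 := (hp.differentiableAt (by simp)).hasFDerivAt
  have h2 : DifferentiableAt ℝ (fderiv ℝ q) z :=
    (hq.fderiv_right (m := 1) (by norm_cast)).differentiableAt (by simp)
  exact h1.clm_apply ((ContinuousLinearMap.apply ℝ E v).hasFDerivAt.comp z h2.hasFDerivAt)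

lemma fderiv_fderiv_symm {E' : Type*} [NormedAddCommGroup E'] [NormedSpace ℝ E'] {q : Z → E'}
    {z : Z} (hq : ContDiffAt ℝ ∞ q z) (v w : Z) :
    fderiv ℝ (fderiv ℝ q) z v w = fderiv ℝ (fderiv ℝ q) z w v :=
  (hq.isSymmSndFDerivAt (by simpa using WithTop.coe_le_coe.2 (le_top : (2 : ℕ∞) ≤ ⊤))) v w

/-- The pullback of the Liouville form of `T*G` under `f`, evaluated at the constant vector field
`v`. -/
def liouville (f : Z → CotangentBundle E G) (v z : Z) : ℝ :=
  (f z).snd (mfderiv 𝓘(ℝ, Z) 𝓘(ℝ, E) (fun z => (f z).proj) z v)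

/-- The chart cancels between `p ∘ dφ⁻¹` and `dφ`. Allowing any chart around the point matters: the
chart can stay fixed while `z` moves. -/
lemma liouville_eq_coords {f : Z → CotangentBundle E G} {z : Z} {g₀ : G}
    (hf : MDifferentiableAt 𝓘(ℝ, Z) (cotangentModel E) f z)
        (hz : (f z).proj ∈ (chartAt E g₀).source) (v : Z) :
    (canonicalCoords g₀ (f z)).2 (fderiv ℝ (fun z => (canonicalCoords g₀ (f z)).1) z v) = liouville
        f v z := by
  have hp : MDifferentiableAt 𝓘(ℝ, Z) 𝓘(ℝ, E) (fun z => (f z).proj) z :=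
    ((contMDiff_cotangent_proj (f z)).mdifferentiableAt (by simp)).comp z hf
  have h := mfderiv_comp_apply (I := 𝓘(ℝ, Z)) (I' := 𝓘(ℝ, E)) (I'' := 𝓘(ℝ, E)) z
      (g := extChartAt 𝓘(ℝ, E) g₀)
    (mdifferentiableAt_extChartAt hz) hp v
  have h2 := mfderiv_extChartAt_symm_apply (I := 𝓘(ℝ, E)) hz
      (mfderiv 𝓘(ℝ, Z) 𝓘(ℝ, E) (fun z => (f z).proj) z v)
  rw [← mfderiv_eq_fderiv]
  exact congrArg (f z).snd (Eq.trans (congrArg _ h) h2)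

lemma dCoords_mfderiv {f : Z → CotangentBundle E G} {z : Z}
    (hf : MDifferentiableAt 𝓘(ℝ, Z) (cotangentModel E) f z) (v : Z) :
    dCoords (f z) (mfderiv 𝓘(ℝ, Z) (cotangentModel E) f z v) =
      fderiv ℝ (fun z' => canonicalCoords (f z).proj (f z')) z v := by
  rw [← mfderiv_eq_fderiv]
  exact (mfderiv_comp_apply z
      ((contMDiffAt_canonicalCoords (mem_chart_source E (f z).proj)).mdifferentiableAt (by simp)) hf
      v).symm

/-- The canonical symplectic form is minus the exterior derivative of the Liouville form. -/
lemma canonicalForm_pullback {f : Z → CotangentBundle E G} {z : Z}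
    (hf : ContMDiffAt 𝓘(ℝ, Z) (cotangentModel E) ∞ f z) (v : Z) :
    DifferentiableAt ℝ (liouville f v) z ∧ ∀ w : Z,
    canonicalForm (f z) (mfderiv 𝓘(ℝ, Z) (cotangentModel E) f z v)
        (mfderiv 𝓘(ℝ, Z) (cotangentModel E) f z w)
      = fderiv ℝ (liouville f v) z w - fderiv ℝ (liouville f w) z v := by
  have hfd := hf.mdifferentiableAt (by simp)
  have hs := mem_chart_source E (f z).proj
  have hc : ContDiffAt ℝ ∞ (fun z' => canonicalCoords (f z).proj (f z')) z :=
    ((contMDiffAt_canonicalCoords hs).comp z hf).contDiffAt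
  have hq := contDiffAt_fst.comp z hc
  have hp := contDiffAt_snd.comp z hc
  -- The chart is frozen at the base point of `f z`, so the coordinate formula holds on a
  -- neighbourhood and may be differentiated.
  have hev : ∀ᶠ z' in 𝓝 z, ∀ v, liouville f v z' = (canonicalCoords (f z).proj (f z')).2
      (fderiv ℝ (fun z' => (canonicalCoords (f z).proj (f z')).1) z' v) := by
    have h1 : ∀ᶠ z' in 𝓝 z, MDifferentiableAt 𝓘(ℝ, Z) (cotangentModel E) f z' := by
      filter_upwards [(contMDiffAt_iff_contMDiffAt_nhds (n := 1) (by simp)).1 (hf.of_le (by simp))]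
          with z' h
      exact h.mdifferentiableAt (by simp)
    have h2 : ∀ᶠ z' in 𝓝 z, (f z').proj ∈ (chartAt E (f z).proj).source :=
      ((contMDiff_cotangent_proj (f z)).continuousAt.comp hf.continuousAt).eventually_mem
        ((chartAt E (f z).proj).open_source.mem_nhds hs)
    filter_upwards [h1, h2] with z' h1 h2 v
    exact (liouville_eq_coords h1 h2 v).symm
  have hl : ∀ v, HasFDerivAt (liouville f v) _ z := fun v =>
    (hasFDerivAt_pairing hp hq v).congr_of_eventuallyEq (hev.mono fun z' h => h v)
  refine ⟨(hl v).differentiableAt, fun w => ?_⟩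
  rw [(hl v).fderiv, (hl w).fderiv]
  have hq' : ∀ v, (fderiv ℝ (fun z' => canonicalCoords (f z).proj (f z')) z v).1
      = fderiv ℝ (Prod.fst ∘ fun z' => canonicalCoords (f z).proj (f z')) z v := by
    intro v
    rw [(hasFDerivAt_fst.comp z (hc.differentiableAt (by simp)).hasFDerivAt).fderiv]; rfl
  have hp' : ∀ v, (fderiv ℝ (fun z' => canonicalCoords (f z).proj (f z')) z v).2
      = fderiv ℝ (Prod.snd ∘ fun z' => canonicalCoords (f z).proj (f z')) z v := by
    intro v
    rw [(hasFDerivAt_snd.comp z (hc.differentiableAt (by simp)).hasFDerivAt).fderiv]; rfl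
  unfold canonicalForm
  rw [dCoords_mfderiv hfd, dCoords_mfderiv hfd, hp', hp', hq', hq']
  simp [fderiv_fderiv_symm hq v w]

/-- This is `d(dS) = 0`: the antisymmetrized derivatives of the two Liouville pullbacks differ by an
antisymmetrized second derivative of `S`. A vector space as source allows the exterior derivative to
be computed on constant fields. -/
lemma canonicalForm_pullback_eq {f₁ f₂ : Z → CotangentBundle E G} {S : Z → ℝ} {z : Z}
    (h₁ : ContMDiffAt 𝓘(ℝ, Z) (cotangentModel E) ∞ f₁ z)
        (h₂ : ContMDiffAt 𝓘(ℝ, Z) (cotangentModel E) ∞ f₂ z)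
    (hS : ContDiffAt ℝ ∞ S z) (h : ∀ᶠ z' in 𝓝 z, ∀ v, liouville f₂ v z' - liouville f₁ v z'
        = fderiv ℝ S z' v) (v w : Z) :
    canonicalForm (f₂ z) (mfderiv 𝓘(ℝ, Z) (cotangentModel E) f₂ z v)
        (mfderiv 𝓘(ℝ, Z) (cotangentModel E) f₂ z w) =
    canonicalForm (f₁ z) (mfderiv 𝓘(ℝ, Z) (cotangentModel E) f₁ z v)
        (mfderiv 𝓘(ℝ, Z) (cotangentModel E) f₁ z w) := by
  rw [(canonicalForm_pullback h₁ v).2 w, (canonicalForm_pullback h₂ v).2 w]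
  have hS2 : DifferentiableAt ℝ (fderiv ℝ S) z :=
    (hS.fderiv_right (m := 1) (by norm_cast)).differentiableAt (by simp)
  have key : ∀ v w, fderiv ℝ (liouville f₂ v) z w - fderiv ℝ (liouville f₁ v) z w
      = fderiv ℝ (fderiv ℝ S) z w v := by
    intro v w
    have e1 := ((canonicalForm_pullback h₂ v).1.hasFDerivAt.sub
        (canonicalForm_pullback h₁ v).1.hasFDerivAt).congr_of_eventuallyEq
      (f₁ := fun z' => fderiv ℝ S z' v) (h.mono fun z' h => (h v).symm)
    have e2 := (ContinuousLinearMap.apply ℝ ℝ v).hasFDerivAt.comp z hS2.hasFDerivAt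
    exact congrArg (fun L : Z →L[ℝ] ℝ => L w) (e1.unique e2)
  have := key v w
  have := key w v
  have := fderiv_fderiv_symm hS v w
  linarith

/-- A map of `T*G` whose pullback changes the Liouville form by an exact form is symplectic. The
hypothesis is expressed in the chart of `T*G` at `x`. -/
lemma canonicalForm_mfderiv_of_exact_chart {F : CotangentBundle E G → CotangentBundle E G}
    {x : CotangentBundle E G} {S : E × (E →L[ℝ] ℝ) → ℝ}
    (hF : ContMDiffAt (cotangentModel E) (cotangentModel E) ∞ F x)
    (hS : ContDiffAt ℝ ∞ S (extChartAt (cotangentModel E) x x))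
    (h : ∀ᶠ z in 𝓝 (extChartAt (cotangentModel E) x x), ∀ v,
      liouville (F ∘ (extChartAt (cotangentModel E) x).symm) v z
        - liouville (extChartAt (cotangentModel E) x).symm v z = fderiv ℝ S z v)
    (v w : TangentSpace (cotangentModel E) x) :
    canonicalForm (F x) (mfderiv (cotangentModel E) (cotangentModel E) F x v)
      (mfderiv (cotangentModel E) (cotangentModel E) F x w) = canonicalForm x v w := by
  set e := extChartAt (cotangentModel E) x
  have hx : x ∈ (chartAt (ModelProd E (E →L[ℝ] ℝ)) x).source := mem_chart_source _ x
  have hex : e.symm (e x) = x := extChartAt_to_inv x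
  have hs : ContMDiffAt 𝓘(ℝ, E × (E →L[ℝ] ℝ)) (cotangentModel E) ∞ e.symm (e x) :=
      contMDiffAt_extChartAt_symm' hx
  have hF' : ContMDiffAt (cotangentModel E) (cotangentModel E) ∞ F (e.symm (e x)) := hex.symm ▸ hF
  -- The comparison is made between the inverse chart and `F` composed with it; afterwards the
  -- derivatives of chart and inverse chart cancel.
  have key := canonicalForm_pullback_eq hs (hF'.comp (e x) hs) hS h
    (mfderiv (cotangentModel E) 𝓘(ℝ, E × (E →L[ℝ] ℝ)) e x v)
        (mfderiv (cotangentModel E) 𝓘(ℝ, E × (E →L[ℝ] ℝ)) e x w)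
  have hv : ∀ v, mfderiv 𝓘(ℝ, E × (E →L[ℝ] ℝ)) (cotangentModel E) e.symm (e x)
      (mfderiv (cotangentModel E) 𝓘(ℝ, E × (E →L[ℝ] ℝ)) e x v) = v :=
    fun v => mfderiv_extChartAt_symm_apply hx v
  have hv2 : ∀ v, mfderiv 𝓘(ℝ, E × (E →L[ℝ] ℝ)) (cotangentModel E) (F ∘ e.symm) (e x)
      (mfderiv (cotangentModel E) 𝓘(ℝ, E × (E →L[ℝ] ℝ)) e x v)
      = mfderiv (cotangentModel E) (cotangentModel E) F x v := by
    intro v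
    have := mfderiv_comp_apply_of_eq (x := e x) (hF.mdifferentiableAt (by simp))
        (hs.mdifferentiableAt (by simp)) hex (mfderiv (cotangentModel E) 𝓘(ℝ, E × (E →L[ℝ] ℝ)) e x
        v)
    exact this.trans (congrArg _ (hv v))
  rw [hv2, hv2, hv, hv] at key
  simp only [Function.comp_apply] at key
  rwa [hex] at key

/-- A map of `T*G` whose pullback changes the Liouville form by an exact form is symplectic. -/
lemma canonicalForm_mfderiv_of_exact {F : CotangentBundle E G → CotangentBundle E G}
    {S : CotangentBundle E G → ℝ}
    {x : CotangentBundle E G} (hF : ContMDiffAt (cotangentModel E) (cotangentModel E) ∞ F x)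
    (hS : ContMDiffAt (cotangentModel E) 𝓘(ℝ, ℝ) ∞ S x)
    (h : ∀ᶠ y in 𝓝 x, ∀ v : TangentSpace (cotangentModel E) y,
      (F y).snd (mfderiv (cotangentModel E) 𝓘(ℝ, E) (fun y => (F y).proj) y v)
        - y.snd (mfderiv (cotangentModel E) 𝓘(ℝ, E) (fun y : CotangentBundle E G => y.proj) y v)
        = mfderiv (cotangentModel E) 𝓘(ℝ, ℝ) S y v)
    (v w : TangentSpace (cotangentModel E) x) :
    canonicalForm (F x) (mfderiv (cotangentModel E) (cotangentModel E) F x v)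
      (mfderiv (cotangentModel E) (cotangentModel E) F x w) = canonicalForm x v w := by
  set e := extChartAt (cotangentModel E) x
  have hx : x ∈ (chartAt (ModelProd E (E →L[ℝ] ℝ)) x).source := mem_chart_source _ x
  have hex : e.symm (e x) = x := extChartAt_to_inv x
  have hs : ContMDiffAt 𝓘(ℝ, E × (E →L[ℝ] ℝ)) (cotangentModel E) ∞ e.symm (e x) :=
      contMDiffAt_extChartAt_symm' hx
  have hS' : ContMDiffAt (cotangentModel E) 𝓘(ℝ, ℝ) ∞ S (e.symm (e x)) := hex.symm ▸ hS
  refine canonicalForm_mfderiv_of_exact_chart hF (hS'.comp (e x) hs).contDiffAt ?_ v w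
  have h1 : ∀ᶠ z in 𝓝 (e x), MDifferentiableAt 𝓘(ℝ, E × (E →L[ℝ] ℝ)) (cotangentModel E) e.symm z
      := by
    filter_upwards [(contMDiffAt_iff_contMDiffAt_nhds (n := 1) (by simp)).1 (hs.of_le (by simp))]
        with z h
    exact h.mdifferentiableAt (by simp)
  have hc : Tendsto e.symm (𝓝 (e x)) (𝓝 x) := by simpa only [hex] using hs.continuousAt.tendsto
  have h2 : ∀ᶠ z in 𝓝 (e x), MDifferentiableAt (cotangentModel E) (cotangentModel E) F (e.symm z)
      := by
    filter_upwards [hc.eventually ((contMDiffAt_iff_contMDiffAt_nhds (n := 1) (by simp)).1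
        (hF.of_le (by simp)))] with z h
    exact h.mdifferentiableAt (by simp)
  have h3 : ∀ᶠ z in 𝓝 (e x), MDifferentiableAt (cotangentModel E) 𝓘(ℝ, ℝ) S (e.symm z) := by
    filter_upwards [hc.eventually ((contMDiffAt_iff_contMDiffAt_nhds (n := 1) (by simp)).1
        (hS.of_le (by simp)))] with z h
    exact h.mdifferentiableAt (by simp)
  filter_upwards [h1, h2, h3, hc.eventually h] with z h1 h2 h3 h4 v
  have e1 := mfderiv_comp_apply z (g := fun y => (F y).proj)
      (((contMDiff_cotangent_proj (F (e.symm z))).mdifferentiableAt (by simp)).comp _ h2) h1 v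
  have e2 := mfderiv_comp_apply z (g := fun y : CotangentBundle E G => y.proj)
      ((contMDiff_cotangent_proj (e.symm z)).mdifferentiableAt (by simp)) h1 v
  have e3 := mfderiv_comp_apply z h3 h1 v
  have h5 := h4 (mfderiv 𝓘(ℝ, E × (E →L[ℝ] ℝ)) (cotangentModel E) e.symm z v)
  rw [← e3, mfderiv_eq_fderiv] at h5
  refine Eq.trans ?_ h5
  exact congrArg₂ (· - ·) (congrArg (F (e.symm z)).snd e1) (congrArg (e.symm z).snd e2)

/-! ### The Maurer-Cartan equation and the trivialized symplectic form. -/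

variable (E) in
/-- The tangent map of the left translation by `g`, read in the charts at `1` and `g₀`. -/
def leftTCoord (g₀ g : G) : E →L[ℝ] E :=
  fderiv ℝ (fun y : E => extChartAt 𝓘(ℝ, E) g₀ (g * (extChartAt 𝓘(ℝ, E) (1 : G)).symm y))
      (extChartAt 𝓘(ℝ, E) (1 : G) 1)

lemma leftTCoord_self (g₀ : G) (ξ : E) : leftTCoord E g₀ g₀ ξ = leftT g₀ ξ := by
  have h := fderiv_leftT g₀ g₀ (mem_chart_source E g₀) ξ
  rw [mfderiv_extChartAt_self] at h
  exact h

lemma contDiffAt_leftTCoord_extChartAt_symm (g₀ : G) :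
    ContDiffAt ℝ ∞ (fun y => leftTCoord E g₀ ((extChartAt 𝓘(ℝ, E) g₀).symm y))
        (extChartAt 𝓘(ℝ, E) g₀ g₀) := by
  have hs := mem_chart_source E g₀
  refine ContMDiffAt.contDiffAt ?_
  refine ContMDiffAt.comp_of_eq (y := g₀) (g := leftTCoord E g₀) (contMDiffAt_leftT_coord hs)
      (contMDiffAt_extChartAt_symm' (I := 𝓘(ℝ, E)) hs) (by simp)

lemma mpullbackWithin_mulInvariantVectorField (g₀ : G) (ξ : E) (y : E)
    (hy : y ∈ (extChartAt 𝓘(ℝ, E) g₀).target) :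
    VectorField.mpullbackWithin 𝓘(ℝ, E) 𝓘(ℝ, E) (extChartAt 𝓘(ℝ, E) g₀).symm
      (mulInvariantVectorField (show GroupLieAlgebra 𝓘(ℝ, E) G from ξ)) univ y = leftTCoord E g₀
          ((extChartAt 𝓘(ℝ, E) g₀).symm y) ξ := by
  have hx := (extChartAt 𝓘(ℝ, E) g₀).map_target hy
  have hyy := (extChartAt 𝓘(ℝ, E) g₀).right_inv hy
  rw [extChartAt_source] at hx
  have hinv := isInvertible_mfderivWithin_extChartAt_symm (I := 𝓘(ℝ, E)) hy
  rw [ModelWithCorners.range_eq_univ] at hinv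
  have h1 := fderiv_leftT g₀ _ hx ξ
  have h2 := mfderiv_extChartAt_symm_apply (I := 𝓘(ℝ, E)) hx (leftT ((extChartAt 𝓘(ℝ, E) g₀).symm y)
      ξ)
  rw [hyy, ← mfderivWithin_univ] at h2
  exact hinv.inverse_apply_eq.2 (h2.symm.trans (congrArg _ h1.symm))

/-- The bracket of left-invariant fields is left-invariant, so it can be evaluated at `g₀`. In the
chart there the fields are `V = Aξ` and `W = Aη` with `A` given by `leftTCoord`, and `[V, W] = DW·V
- DV·W`; the derivative of that chart at `g₀` is the identity. -/
lemma leftT_lieBracket [FiniteDimensional ℝ E] (g₀ : G) (ξ η : E) :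
    leftT g₀ (lieBracket G ξ η) =
      fderiv ℝ (fun y => leftTCoord E g₀ ((extChartAt 𝓘(ℝ, E) g₀).symm y))
          (extChartAt 𝓘(ℝ, E) g₀ g₀) (leftTCoord E g₀ g₀ ξ) η
      - fderiv ℝ (fun y => leftTCoord E g₀ ((extChartAt 𝓘(ℝ, E) g₀).symm y))
          (extChartAt 𝓘(ℝ, E) g₀ g₀) (leftTCoord E g₀ g₀ η) ξ := by
  have : CompleteSpace E := FiniteDimensional.complete ℝ E
  have : LieGroup 𝓘(ℝ, E) (minSmoothness ℝ 3) G := LieGroup.of_le (n := ∞)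
      (by simpa using ENat.LEInfty.out)
  have h := congrFun (mulInvariantVector_mlieBracket (I := 𝓘(ℝ, E)) (G := G) ξ η) g₀
  refine h.trans ?_
  have e := VectorField.mlieBracketWithin_apply (I := 𝓘(ℝ, E)) (s := univ) (x₀ := g₀)
    (V := mulInvariantVectorField (show GroupLieAlgebra 𝓘(ℝ, E) G from ξ))
    (W := mulInvariantVectorField (show GroupLieAlgebra 𝓘(ℝ, E) G from η))
  rw [mfderiv_extChartAt_self, VectorField.mlieBracketWithin_univ, ModelWithCorners.range_eq_univ,
    preimage_univ, univ_inter] at e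
  have hid : (ContinuousLinearMap.id ℝ E).inverse = ContinuousLinearMap.id ℝ E :=
    ContinuousLinearMap.inverse_id
  refine e.trans ((congrArg (fun L : E →L[ℝ] E => L _) hid).trans ?_)
  have hev : ∀ ξ : E, VectorField.mpullbackWithin 𝓘(ℝ, E) 𝓘(ℝ, E) (extChartAt 𝓘(ℝ, E) g₀).symm
      (mulInvariantVectorField (show GroupLieAlgebra 𝓘(ℝ, E) G from ξ)) univ
          =ᶠ[𝓝 (extChartAt 𝓘(ℝ, E) g₀ g₀)]
      fun y => leftTCoord E g₀ ((extChartAt 𝓘(ℝ, E) g₀).symm y) ξ := by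
    intro ξ
    filter_upwards [extChartAt_target_mem_nhds (I := 𝓘(ℝ, E)) g₀] with y hy
    exact mpullbackWithin_mulInvariantVectorField g₀ ξ y hy
  have hl := Filter.EventuallyEq.lieBracket_vectorField_eq (𝕜 := ℝ) (hev ξ) (hev η)
  refine (congrFun (VectorField.lieBracketWithin_univ (𝕜 := ℝ)) _).trans (hl.trans ?_)
  have hd := (contDiffAt_leftTCoord_extChartAt_symm (E := E) g₀).differentiableAt (by simp)
  have hf : ∀ ξ : E, fderiv ℝ (fun y => leftTCoord E g₀ ((extChartAt 𝓘(ℝ, E) g₀).symm y) ξ)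
      (extChartAt 𝓘(ℝ, E) g₀ g₀)
     = (ContinuousLinearMap.apply ℝ E ξ).comp
         (fderiv ℝ (fun y => leftTCoord E g₀ ((extChartAt 𝓘(ℝ, E) g₀).symm y))
         (extChartAt 𝓘(ℝ, E) g₀ g₀)) :=
    fun ξ => ((ContinuousLinearMap.apply ℝ E ξ).hasFDerivAt.comp _ hd.hasFDerivAt).fderiv
  rw [VectorField.lieBracket, hf, hf]
  simp only [extChartAt_to_inv]
  rfl

/-- The pullback of the left Maurer-Cartan form of `G` under `γ`, evaluated at the constant vector
field `v`. -/
def maurerCartan (γ : Z → G) (v z : Z) : E :=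
  leftTInv (γ z) (mfderiv 𝓘(ℝ, Z) 𝓘(ℝ, E) γ z v)

/-- The Maurer-Cartan structure equation. -/
lemma fderiv_maurerCartan [FiniteDimensional ℝ E] {γ : Z → G} {z : Z}
    (hγ : ContMDiffAt 𝓘(ℝ, Z) 𝓘(ℝ, E) ∞ γ z) :
    (∀ v, DifferentiableAt ℝ (maurerCartan (E := E) γ v) z) ∧ ∀ v w,
      fderiv ℝ (maurerCartan (E := E) γ v) z w - fderiv ℝ (maurerCartan (E := E) γ w) z v
        = lieBracket G (maurerCartan γ v z) (maurerCartan γ w z) := by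
  have hs := mem_chart_source E (γ z)
  set φ := extChartAt 𝓘(ℝ, E) (γ z)
  have hu : ContDiffAt ℝ ∞ (fun z' => φ (γ z')) z :=
    (ContMDiffAt.comp z (g := φ) contMDiffAt_extChartAt hγ).contDiffAt
  have hB : ContDiffAt ℝ ∞ (fun z' => (fun g : G =>
      fderiv ℝ (fun y : E => extChartAt 𝓘(ℝ, E) (1 : G) (g⁻¹ * φ.symm y)) (φ g)) (γ z')) z :=
    (ContMDiffAt.comp z (contMDiffAt_leftTInv_coord hs) hγ).contDiffAt
  have hA := contDiffAt_leftTCoord_extChartAt_symm (E := E) (γ z)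
  have hAu : HasFDerivAt (fun z' => leftTCoord E (γ z) (φ.symm (φ (γ z')))) _ z :=
    HasFDerivAt.comp z (g := fun y => leftTCoord E (γ z) (φ.symm y))
        (hA.differentiableAt (by simp)).hasFDerivAt (hu.differentiableAt (by simp)).hasFDerivAt
  have hev : ∀ᶠ z' in 𝓝 z, γ z' ∈ (chartAt E (γ z)).source ∧ MDifferentiableAt 𝓘(ℝ, Z) 𝓘(ℝ, E) γ z'
      := by
    filter_upwards [hγ.continuousAt.eventually_mem ((chartAt E (γ z)).open_source.mem_nhds hs),
      (contMDiffAt_iff_contMDiffAt_nhds (n := 1) (by simp)).1 (hγ.of_le (by simp))] with z' h1 h2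
    exact ⟨h1, h2.mdifferentiableAt (by simp)⟩
  have hdu : ∀ᶠ z' in 𝓝 z, ∀ v, fderiv ℝ (fun z' => φ (γ z')) z' v
      = mfderiv 𝓘(ℝ, E) 𝓘(ℝ, E) φ (γ z') (mfderiv 𝓘(ℝ, Z) 𝓘(ℝ, E) γ z' v) := by
    filter_upwards [hev] with z' h v
    rw [← mfderiv_eq_fderiv]
    exact mfderiv_comp_apply (I := 𝓘(ℝ, Z)) (I' := 𝓘(ℝ, E)) (I'' := 𝓘(ℝ, E)) z' (g := φ)
      (mdifferentiableAt_extChartAt h.1) h.2 v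
  -- This expression only serves to show that `ω` is differentiable.
  have hω : ∀ᶠ z' in 𝓝 z, ∀ v, maurerCartan (E := E) γ v z' = (fun g : G =>
      fderiv ℝ (fun y : E => extChartAt 𝓘(ℝ, E) (1 : G) (g⁻¹ * φ.symm y)) (φ g)) (γ z')
        (fderiv ℝ (fun z' => φ (γ z')) z' v) := by
    filter_upwards [hev, hdu] with z' h h2 v
    rw [h2 v]
    refine Eq.trans ?_ (fderiv_leftTInv (γ z) (γ z') h.1 _).symm
    exact congrArg _ (mfderiv_extChartAt_symm_apply (I := 𝓘(ℝ, E)) h.1 _).symm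
  -- The identity to differentiate is `A(u) ω = du`, with `u` the chart expression of `γ`. Its
  -- derivative has the symmetric right side `D²u`, so antisymmetrizing leaves `A(dω)` against the
  -- derivative of `A`, which is the bracket; then `A` is inverted at `γ z`.
  have hAω : ∀ᶠ z' in 𝓝 z, ∀ v, leftTCoord E (γ z) (φ.symm (φ (γ z'))) (maurerCartan γ v z')
      = fderiv ℝ (fun z' => φ (γ z')) z' v := by
    filter_upwards [hev, hdu] with z' h h2 v
    rw [h2 v, φ.left_inv (by simpa [φ] using h.1)]
    refine (fderiv_leftT (γ z) (γ z') h.1 _).trans ?_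
    exact congrArg _ (leftT_leftTInv _ _)
  have hD2 : DifferentiableAt ℝ (fderiv ℝ (fun z' => φ (γ z'))) z :=
    (hu.fderiv_right (m := 1) (by norm_cast)).differentiableAt (by simp)
  have hDv : ∀ v, HasFDerivAt (fun z' => fderiv ℝ (fun z' => φ (γ z')) z' v) _ z := fun v =>
    (ContinuousLinearMap.apply ℝ E v).hasFDerivAt.comp z hD2.hasFDerivAt
  have hd : ∀ v, DifferentiableAt ℝ (maurerCartan (E := E) γ v) z := fun v =>
    ((hB.differentiableAt (by simp)).clm_apply (hDv v).differentiableAt).congr_of_eventuallyEq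
      (hω.mono fun z' h => h v)
  refine ⟨hd, fun v w => ?_⟩
  have key : ∀ v w, fderiv ℝ (fun y => leftTCoord E (γ z) (φ.symm y)) (φ (γ z))
      (leftTCoord E (γ z) (γ z) (maurerCartan γ w z)) (maurerCartan γ v z)
      + leftTCoord E (γ z) (γ z) (fderiv ℝ (maurerCartan (E := E) γ v) z w)
          = fderiv ℝ (fderiv ℝ (fun z' => φ (γ z'))) z w v := by
    intro v w
    have e1 := (hAu.clm_apply (hd v).hasFDerivAt).congr_of_eventuallyEq
      (f₁ := fun z' => fderiv ℝ (fun z' => φ (γ z')) z' v) (hAω.mono fun z' h => (h v).symm)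
    have e2 := congrArg (fun L : Z →L[ℝ] E => L w) (e1.unique (hDv v))
    have e3 := hAω.self_of_nhds w
    rw [φ.left_inv (by simp [φ])] at e3
    rw [e3, add_comm]
    rw [φ.left_inv (by simp [φ])] at e2
    exact e2
  have hb := (leftTCoord_self (E := E) (γ z) _).trans
    (leftT_lieBracket (γ z) (maurerCartan (E := E) γ v z) (maurerCartan γ w z))
  have k1 := key v w
  have k2 := key w v
  rw [fderiv_fderiv_symm hu w v] at k1
  have hfin : leftTCoord E (γ z) (γ z) (fderiv ℝ (maurerCartan (E := E) γ v) z w - fderiv ℝ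
      (maurerCartan (E := E) γ w) z v)
      = leftTCoord E (γ z) (γ z) (lieBracket G (maurerCartan γ v z) (maurerCartan γ w z)) := by
    refine (map_sub _ _ _).trans (Eq.trans ?_ hb.symm)
    have : ∀ a b c d e : E, a + b = e → c + d = e → b - d = c - a := by
      intro a b c d e h1 h2
      rw [eq_sub_of_add_eq' h1, eq_sub_of_add_eq' h2]; abel
    exact this _ _ _ _ _ k1 k2
  rw [leftTCoord_self, leftTCoord_self] at hfin
  have := congrArg (leftTInv (γ z)) hfin
  rwa [leftTInv_leftT, leftTInv_leftT] at this

lemma liouville_eq_maurerCartan (f : Z → CotangentBundle E G) (v z : Z) :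
    liouville f v z = (triv (f z)).2 (maurerCartan (fun z => (f z).proj) v z) :=
  (congrArg (f z).snd (leftT_leftTInv _ _)).symm

/-- In `-d⟨μ, ω⟩` the product rule gives the two `δμ` terms, and the structure equation turns the
derivatives of `ω` into `⟨μ, [·, ·]⟩`. -/
lemma trivForm_mfderiv_comp [FiniteDimensional ℝ E] {f : Z → CotangentBundle E G} {z : Z}
    (hf : ContMDiffAt 𝓘(ℝ, Z) (cotangentModel E) ∞ f z) (v w : Z) :
    trivForm (triv (f z)) (mfderiv 𝓘(ℝ, Z) (cotangentModel E) (fun z => triv (f z)) z v)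
      (mfderiv 𝓘(ℝ, Z) (cotangentModel E) (fun z => triv (f z)) z w)
    = canonicalForm (f z) (mfderiv 𝓘(ℝ, Z) (cotangentModel E) f z v)
      (mfderiv 𝓘(ℝ, Z) (cotangentModel E) f z w) := by
  have hγ : ContMDiffAt 𝓘(ℝ, Z) 𝓘(ℝ, E) ∞ (fun z => (f z).proj) z :=
      (contMDiff_cotangent_proj _).comp z hf
  have hμ : ContMDiffAt 𝓘(ℝ, Z) 𝓘(ℝ, E →L[ℝ] ℝ) ∞ (fun z => (triv (f z)).2) z :=
    contMDiffAt_snd.comp z ((contMDiff_triv _).comp z hf)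
  have hμd := (hμ.contDiffAt.differentiableAt (by simp)).hasFDerivAt
  have hm := mfderiv_prodMk (hγ.mdifferentiableAt (by simp)) (hμ.mdifferentiableAt (by simp))
  obtain ⟨hω, hmc⟩ := fderiv_maurerCartan hγ
  have hl : ∀ v w, fderiv ℝ (liouville f v) z w = (triv (f z)).2
      (fderiv ℝ (maurerCartan (E := E) (fun z => (f z).proj) v) z w)
      + fderiv ℝ (fun z => (triv (f z)).2) z w (maurerCartan (fun z => (f z).proj) v z) := by
    intro v w
    have := (hμd.clm_apply (hω v).hasFDerivAt).congr_of_eventuallyEq (f₁ := liouville f v)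
      (Eventually.of_forall fun z => liouville_eq_maurerCartan f v z)
    rw [this.fderiv]
    simp
  rw [(canonicalForm_pullback hf v).2 w, hl, hl]
  have e : (triv (f z)).2 (fderiv ℝ (maurerCartan (E := E) (fun z => (f z).proj) v) z w)
     = (triv (f z)).2 (lieBracket G (maurerCartan (fun z => (f z).proj) v z)
         (maurerCartan (fun z => (f z).proj) w z))
     + (triv (f z)).2 (fderiv ℝ (maurerCartan (E := E) (fun z => (f z).proj) w) z v) := by
    rw [← hmc v w, ← map_add]; simp
  rw [e]
  have h1 : ∀ v, (mfderiv 𝓘(ℝ, Z) (cotangentModel E) (fun z => triv (f z)) z v) = 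
    ((mfderiv 𝓘(ℝ, Z) 𝓘(ℝ, E) (fun z => (f z).proj) z v : E), fderiv ℝ (fun z => (triv (f z)).2) z
        v) := by
    intro v
    rw [← mfderiv_eq_fderiv]
    exact congrArg (fun L : Z →L[ℝ] E × (E →L[ℝ] ℝ) => L v) hm
  refine (congrArg₂ (trivForm (triv (f z))) (h1 v) (h1 w)).trans ?_
  have h2 : ∀ v w : Z, trivForm (triv (f z))
      ((mfderiv 𝓘(ℝ, Z) 𝓘(ℝ, E) (fun z => (f z).proj) z v : E), fderiv ℝ (fun z => (triv (f z)).2) z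
      v)
      ((mfderiv 𝓘(ℝ, Z) 𝓘(ℝ, E) (fun z => (f z).proj) z w : E), fderiv ℝ (fun z => (triv (f z)).2) z
          w)
      = (triv (f z)).2 (lieBracket G (maurerCartan (fun z => (f z).proj) v z)
          (maurerCartan (fun z => (f z).proj) w z))
      + fderiv ℝ (fun z => (triv (f z)).2) z w (maurerCartan (fun z => (f z).proj) v z)
      - fderiv ℝ (fun z => (triv (f z)).2) z v (maurerCartan (fun z => (f z).proj) w z) :=
          fun v w => rfl
  refine (h2 v w).trans ?_
  ring

/-- The form `trivForm` is the left trivialization of the canonical symplectic form. -/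
lemma trivForm_mfderiv_triv [FiniteDimensional ℝ E] (x : CotangentBundle E G)
    (v w : TangentSpace (cotangentModel E) x) :
    trivForm (triv x) (mfderiv (cotangentModel E) (cotangentModel E) triv x v)
      (mfderiv (cotangentModel E) (cotangentModel E) triv x w) = canonicalForm x v w := by
  set e := extChartAt (cotangentModel E) x
  have hx : x ∈ (chartAt (ModelProd E (E →L[ℝ] ℝ)) x).source := mem_chart_source _ x
  have hex : e.symm (e x) = x := extChartAt_to_inv x
  have hs : ContMDiffAt 𝓘(ℝ, E × (E →L[ℝ] ℝ)) (cotangentModel E) ∞ e.symm (e x) :=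
      contMDiffAt_extChartAt_symm' hx
  have key := trivForm_mfderiv_comp hs
    (mfderiv (cotangentModel E) 𝓘(ℝ, E × (E →L[ℝ] ℝ)) e x v)
        (mfderiv (cotangentModel E) 𝓘(ℝ, E × (E →L[ℝ] ℝ)) e x w)
  have hv : ∀ v, mfderiv 𝓘(ℝ, E × (E →L[ℝ] ℝ)) (cotangentModel E) e.symm (e x)
      (mfderiv (cotangentModel E) 𝓘(ℝ, E × (E →L[ℝ] ℝ)) e x v) = v :=
    fun v => mfderiv_extChartAt_symm_apply hx v
  have hv2 : ∀ v, mfderiv 𝓘(ℝ, E × (E →L[ℝ] ℝ)) (cotangentModel E) (fun z => triv (e.symm z)) (e x)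
      (mfderiv (cotangentModel E) 𝓘(ℝ, E × (E →L[ℝ] ℝ)) e x v)
      = mfderiv (cotangentModel E) (cotangentModel E) triv x v := by
    intro v
    have := mfderiv_comp_apply_of_eq (x := e x) ((contMDiff_triv x).mdifferentiableAt (by simp))
        (hs.mdifferentiableAt (by simp)) hex (mfderiv (cotangentModel E) 𝓘(ℝ, E × (E →L[ℝ] ℝ)) e x
        v)
    exact this.trans (congrArg _ (hv v))
  rw [hv2, hv2, hv, hv] at key
  rwa [hex] at key

lemma IsSymplecticOn.trivialized [FiniteDimensional ℝ E] {F : CotangentBundle E G → CotangentBundle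
    E G}
    {U : Set (CotangentBundle E G)} (hU : IsOpen U) (hF : ContMDiffOn (cotangentModel E)
        (cotangentModel E) ∞ F U)
    (h : IsSymplecticOn F U) : IsTrivSymplecticOn (triv ∘ F ∘ trivInv) (trivInv ⁻¹' U) := by
  intro y hy v w
  have hFd : MDifferentiableAt (cotangentModel E) (cotangentModel E) F (trivInv y) :=
    (hF.contMDiffAt (hU.mem_nhds hy)).mdifferentiableAt (by simp)
  have hi := (contMDiff_trivInv (E := E) y).mdifferentiableAt (by simp)
  have ht : ∀ x : CotangentBundle E G, MDifferentiableAt (cotangentModel E) (cotangentModel E) triv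
      x :=
    fun x => (contMDiff_triv x).mdifferentiableAt (by simp)
  have e1 : ∀ v, mfderiv (cotangentModel E) (cotangentModel E) (triv ∘ F ∘ trivInv) y v =
      mfderiv (cotangentModel E) (cotangentModel E) triv (F (trivInv y))
          (mfderiv (cotangentModel E) (cotangentModel E) F (trivInv y)
        (mfderiv (cotangentModel E) (cotangentModel E) trivInv y v)) := by
    intro v
    have h1 := mfderiv_comp_apply y (ht (F (trivInv y))) (hFd.comp y hi) v
    exact h1.trans (congrArg _ (mfderiv_comp_apply y hFd hi v))
  -- Differentiating `λ ∘ λ⁻¹ = id` lets the pullback formula for `λ` be used at both ends.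
  have e2 : ∀ v, mfderiv (cotangentModel E) (cotangentModel E) triv (trivInv y)
        (mfderiv (cotangentModel E) (cotangentModel E) trivInv y v) = v := by
    intro v
    have h1 := mfderiv_comp_apply y (ht (trivInv y)) hi v
    have h2 : (triv : CotangentBundle E G → _) ∘ trivInv = id := funext triv_trivInv
    rw [h2, mfderiv_id] at h1
    exact h1.symm
  rw [e1, e1]
  refine (trivForm_mfderiv_triv (F (trivInv y)) _ _).trans ?_
  refine (h _ hy _ _).trans ?_
  refine (trivForm_mfderiv_triv (trivInv y) _ _).symm.trans ?_
  rw [e2, e2]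
  rw [triv_trivInv]

/-! ### Variations of the group increments, of `τ⁻¹` and of the Hamiltonians. -/

lemma mdifferentiable_inv_mul (p : G × G) :
    MDifferentiableAt ((𝓘(ℝ, E)).prod 𝓘(ℝ, E)) 𝓘(ℝ, E) (fun p : G × G => p.1⁻¹ * p.2) p :=
  ((contMDiff_fst.inv.mul contMDiff_snd : ContMDiff ((𝓘(ℝ, E)).prod 𝓘(ℝ, E)) 𝓘(ℝ, E) ∞
    (fun p : G × G => p.1⁻¹ * p.2)) p).mdifferentiableAt (by simp)

lemma mdifferentiable_inv (a : G) : MDifferentiableAt 𝓘(ℝ, E) 𝓘(ℝ, E) (fun x : G => x⁻¹) a :=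
  ((contMDiff_inv 𝓘(ℝ, E) ∞ : ContMDiff 𝓘(ℝ, E) 𝓘(ℝ, E) ∞ fun x : G => x⁻¹) a).mdifferentiableAt
      (by simp)

/-- Differentiate `x⁻¹ x = 1` along the diagonal. -/
lemma mfderiv_inv_one (ξ : E) : (mfderiv 𝓘(ℝ, E) 𝓘(ℝ, E) (fun x : G => x⁻¹) (1 : G) ξ : E)
    = -ξ := by
  have hd := mdifferentiable_inv_mul (E := E) ((1, 1) : G × G)
  have h0 := mfderiv_comp_apply (I := 𝓘(ℝ, E)) (1 : G) (f := fun x : G => (x, x)) hd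
    (mdifferentiableAt_id.prodMk mdifferentiableAt_id) ξ
  have h1 : (fun p : G × G => p.1⁻¹ * p.2) ∘ (fun x : G => (x, x)) = fun _ => 1 := by ext; simp
  rw [h1, mfderiv_const, mfderiv_prod_eq_add_apply hd] at h0
  have h2 := mfderiv_prodMk (I := 𝓘(ℝ, E)) (I' := 𝓘(ℝ, E)) (I'' := 𝓘(ℝ, E)) (x := (1 : G)) (f := id)
      (g := id) mdifferentiableAt_id mdifferentiableAt_id
  have h3 : (mfderiv 𝓘(ℝ, E) ((𝓘(ℝ, E)).prod 𝓘(ℝ, E)) (fun x : G => (x, x)) 1 ξ : E × E)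
      = (ξ, ξ) := by
    refine (congrArg (fun L : E →L[ℝ] E × E => L ξ) h2).trans ?_
    rw [mfderiv_id]
    rfl
  have h4 : (0 : E) = (fun a b : E => a + b) (mfderiv 𝓘(ℝ, E) 𝓘(ℝ, E) (fun x : G => x⁻¹) (1 : G) ξ)
      ξ := by
    refine h0.trans ?_
    refine congrArg₂ (fun a b : E => a + b) ?_ ?_
    · refine (congrArg _ (congrArg Prod.fst h3)).trans ?_
      exact congrArg (fun f : G → G => (mfderiv 𝓘(ℝ, E) 𝓘(ℝ, E) f 1 : E →L[ℝ] E) ξ)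
        (funext fun x : G => mul_one x⁻¹)
    · refine (congrArg _ (congrArg Prod.snd h3)).trans ?_
      refine (congrArg (fun f : G → G => (mfderiv 𝓘(ℝ, E) 𝓘(ℝ, E) f 1 : E →L[ℝ] E) ξ)
        (funext fun x : G => show (1 : G)⁻¹ * x = id x by simp)).trans ?_
      exact congrArg (fun L : E →L[ℝ] E => L ξ) (mfderiv_id (I := 𝓘(ℝ, E)) (x := (1 : G)))
  exact (neg_eq_of_add_eq_zero_left h4.symm).symm

/-- With `c = a⁻¹ b`, one has `a⁻¹ (b x) = (c x c⁻¹) c`. The right translation is kept outside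
because `dInv` is right trivialized. -/
lemma mfderiv_inv_mul_left (a b : G) (ξ : E) :
    mfderiv 𝓘(ℝ, E) 𝓘(ℝ, E) (fun x : G => a⁻¹ * x) b (leftT b ξ) = rightT (a⁻¹ * b) (Ad (a⁻¹ * b) ξ)
        := by
  have h1 := mfderiv_comp_apply_of_eq (I := 𝓘(ℝ, E)) (I' := 𝓘(ℝ, E)) (I'' := 𝓘(ℝ, E)) (x := (1 : G))
      (y := b)
    (f := fun x : G => b * x) (mdifferentiableAt_mul_left a⁻¹ b) (mdifferentiableAt_mul_left _ _)
        (by simp) ξ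
  have hc : MDifferentiableAt 𝓘(ℝ, E) 𝓘(ℝ, E) (fun x : G => a⁻¹ * b * x * (a⁻¹ * b)⁻¹) 1 :=
    (mdifferentiableAt_mul_right _ _).comp (1 : G) (mdifferentiableAt_mul_left (a⁻¹ * b) 1)
  have h2 := mfderiv_comp_apply_of_eq (I := 𝓘(ℝ, E)) (I' := 𝓘(ℝ, E)) (I'' := 𝓘(ℝ, E)) (x := (1 : G))
      (y := (1 : G))
    (f := fun x : G => a⁻¹ * b * x * (a⁻¹ * b)⁻¹) (mdifferentiableAt_mul_right (a⁻¹ * b) 1) hc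
        (by simp) ξ
  have h3 : (fun x : G => a⁻¹ * x) ∘ (fun x : G => b * x) = (fun x : G => x * (a⁻¹ * b)) ∘
      (fun x : G => a⁻¹ * b * x * (a⁻¹ * b)⁻¹) := by
    ext x; simp [mul_assoc]
  rw [h3] at h1
  exact h1.symm.trans h2

lemma mfderiv_inv_mul_right (a b : G) (ξ : E) :
    mfderiv 𝓘(ℝ, E) 𝓘(ℝ, E) (fun x : G => x⁻¹ * b) a (leftT a ξ) = rightT (a⁻¹ * b) (-ξ) := by
  have hd : MDifferentiableAt 𝓘(ℝ, E) 𝓘(ℝ, E) (fun x : G => x⁻¹ * b) a :=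
    (mdifferentiableAt_mul_right b _).comp a (mdifferentiable_inv a)
  have h1 := mfderiv_comp_apply_of_eq (I := 𝓘(ℝ, E)) (I' := 𝓘(ℝ, E)) (I'' := 𝓘(ℝ, E)) (x := (1 : G))
      (y := a)
    (f := fun x : G => a * x) hd (mdifferentiableAt_mul_left _ _) (by simp) ξ
  have h2 := mfderiv_comp_apply_of_eq (I := 𝓘(ℝ, E)) (I' := 𝓘(ℝ, E)) (I'' := 𝓘(ℝ, E)) (x := (1 : G))
      (y := (1 : G))
    (f := fun x : G => x⁻¹) (mdifferentiableAt_mul_right (a⁻¹ * b) 1) (mdifferentiable_inv 1)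
        (by simp) ξ
  have h3 : (fun x : G => x⁻¹ * b) ∘ (fun x : G => a * x) = (fun x : G => x * (a⁻¹ * b)) ∘
      (fun x : G => x⁻¹) := by
    ext x; simp [mul_assoc]
  rw [h3] at h1
  exact h1.symm.trans (h2.trans (congrArg _ (mfderiv_inv_one ξ)))

lemma mfderiv_inv_mul {a b : Z → G} {z : Z} (ha : MDifferentiableAt 𝓘(ℝ, Z) 𝓘(ℝ, E) a z)
    (hb : MDifferentiableAt 𝓘(ℝ, Z) 𝓘(ℝ, E) b z) (v : Z) :
    mfderiv 𝓘(ℝ, Z) 𝓘(ℝ, E) (fun z => (a z)⁻¹ * b z) z v =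
      rightT ((a z)⁻¹ * b z) (Ad ((a z)⁻¹ * b z) (maurerCartan b v z) - maurerCartan a v z) := by
  have hd := mdifferentiable_inv_mul (E := E) (a z, b z)
  have h0 := mfderiv_comp_apply z (f := fun z => (a z, b z)) hd (ha.prodMk hb) v
  rw [mfderiv_prod_eq_add_apply hd] at h0
  have h2 := mfderiv_prodMk ha hb
  have h3 : (mfderiv 𝓘(ℝ, Z) ((𝓘(ℝ, E)).prod 𝓘(ℝ, E)) (fun z => (a z, b z)) z v : E × E) =
      (leftT (a z) (maurerCartan a v z), leftT (b z) (maurerCartan b v z)) := by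
    refine (congrArg (fun L : Z →L[ℝ] E × E => L v) h2).trans ?_
    exact congrArg₂ Prod.mk (leftT_leftTInv (a z) _).symm (leftT_leftTInv (b z) _).symm
  refine h0.trans ?_
  have h5 : ∀ x y : E, rightT ((a z)⁻¹ * b z) (x - y) = rightT ((a z)⁻¹ * b z) (-y) + rightT
      ((a z)⁻¹ * b z) x := by
    intro x y
    rw [← map_add]; congr 1; abel
  rw [h5]
  refine congrArg₂ (fun a b : E => a + b) ?_ ?_
  · refine (congrArg _ (congrArg Prod.fst h3)).trans ?_
    exact mfderiv_inv_mul_right _ _ _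
  · refine (congrArg _ (congrArg Prod.snd h3)).trans ?_
    exact mfderiv_inv_mul_left _ _ _

lemma RetractionMap.contMDiffAt_invFun (τ : RetractionMap E G) {g : G} (hg : g ∈ τ.target) :
    ContMDiffAt 𝓘(ℝ, E) 𝓘(ℝ, E) ∞ τ.invFun g :=
  τ.contMDiffOn_invFun.contMDiffAt (τ.open_target.mem_nhds hg)

lemma RetractionMap.toFun_invFun (τ : RetractionMap E G) {g : G} (hg : g ∈ τ.target) : τ.toFun
    (τ.invFun g) = g :=
  τ.right_inv' hg

/-- The right endpoint varies through `Ad` and the left one through `-1`: this asymmetry is why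
`coAd` stands on only one momentum in each equation of the scheme. -/
lemma RetractionMap.hasFDerivAt_invFun (τ : RetractionMap E G) {a b : Z → G} {z : Z}
    (ha : MDifferentiableAt 𝓘(ℝ, Z) 𝓘(ℝ, E) a z)
    (hb : MDifferentiableAt 𝓘(ℝ, Z) 𝓘(ℝ, E) b z) (hc : (a z)⁻¹ * b z ∈ τ.target) :
    DifferentiableAt ℝ (fun z => τ.invFun ((a z)⁻¹ * b z)) z ∧ ∀ v,
    fderiv ℝ (fun z => τ.invFun ((a z)⁻¹ * b z)) z v =
      τ.dInv (τ.invFun ((a z)⁻¹ * b z)) (Ad ((a z)⁻¹ * b z) (maurerCartan b v z) - maurerCartan a v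
          z) := by
  have hτ := (τ.contMDiffAt_invFun hc).mdifferentiableAt (by simp)
  have hab : MDifferentiableAt 𝓘(ℝ, Z) 𝓘(ℝ, E) (fun z => (a z)⁻¹ * b z) z :=
    (mdifferentiable_inv_mul (a z, b z)).comp z (ha.prodMk hb)
  refine ⟨(hτ.comp z hab).differentiableAt, fun v => ?_⟩
  have h := mfderiv_comp_apply z hτ hab v
  rw [← mfderiv_eq_fderiv, RetractionMap.dInv, τ.toFun_invFun hc]
  exact h.trans (congrArg _ (mfderiv_inv_mul ha hb v))

lemma contMDiff_trivHam {H : CotangentBundle E G → ℝ} (hH : ContMDiff (cotangentModel E) 𝓘(ℝ, ℝ) ∞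
    H) :
    ContMDiff (cotangentModel E) 𝓘(ℝ, ℝ) ∞ (trivHam H) :=
  hH.comp contMDiff_trivInv

lemma fderiv_trivHam {H : CotangentBundle E G → ℝ} (hH : ContMDiff (cotangentModel E) 𝓘(ℝ, ℝ) ∞ H)
    {g : Z → G} {μ : Z → E →L[ℝ] ℝ} {z : Z}
    (hg : MDifferentiableAt 𝓘(ℝ, Z) 𝓘(ℝ, E) g z) (hμ : DifferentiableAt ℝ μ z) :
    DifferentiableAt ℝ (fun z => trivHam H (g z, μ z)) z ∧ ∀ v,
        fderiv ℝ (fun z => trivHam H (g z, μ z)) z v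
      = partialG (trivHam H) (g z) (μ z) (maurerCartan g v z) + partialMu (trivHam H) (g z) (μ z)
          (fderiv ℝ μ z v) := by
  have hd := (contMDiff_trivHam hH (g z, μ z)).mdifferentiableAt (by simp)
  have hm := hg.prodMk hμ.mdifferentiableAt
  refine ⟨(MDifferentiableAt.comp z (g := trivHam H) hd hm).differentiableAt, fun v => ?_⟩
  have h0 := mfderiv_comp_apply z (f := fun z => (g z, μ z)) hd hm v
  rw [mfderiv_prod_eq_add_apply hd] at h0
  have h2 := mfderiv_prodMk hg hμ.mdifferentiableAt
  have h3 : (mfderiv 𝓘(ℝ, Z) (cotangentModel E) (fun z => (g z, μ z)) z v : E × (E →L[ℝ] ℝ)) =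
      (leftT (g z) (maurerCartan g v z), fderiv ℝ μ z v) := by
    refine (congrArg (fun L : Z →L[ℝ] E × (E →L[ℝ] ℝ) => L v) h2).trans ?_
    exact congrArg₂ Prod.mk (leftT_leftTInv (g z) _).symm (by rw [mfderiv_eq_fderiv]; rfl)
  rw [← mfderiv_eq_fderiv]
  refine h0.trans ?_
  refine congrArg₂ (fun a b : ℝ => a + b) ?_ ?_
  · exact congrArg _ (congrArg Prod.fst h3)
  · refine (congrArg _ (congrArg Prod.snd h3)).trans ?_
    rw [mfderiv_eq_fderiv]
    rfl

/-! ### The first variation of the discrete action. -/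

lemma sum_fin_sub_telescope {K : ℕ} [NeZero K] (R L : Fin K → ℝ)
    (h : ∀ (k : ℕ) (hk : k + 1 < K), R ⟨k, by omega⟩ = L ⟨k + 1, hk⟩) :
    ∑ k, (R k - L k) = R (Fin.rev 0) - L 0 := by
  obtain ⟨n, rfl⟩ := Nat.exists_eq_succ_of_ne_zero (NeZero.ne K)
  rw [Finset.sum_sub_distrib, Fin.sum_univ_castSucc, Fin.sum_univ_succ (f := L)]
  have : ∀ k : Fin n, R k.castSucc = L k.succ := fun k => h k (by omega)
  simp only [this, Fin.rev_zero]
  ring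

lemma fderiv_action_term {N : ℕ} {μ₁ μ₂ : Z → E →L[ℝ] ℝ} {X Y : Z → E} {h : Z → ℝ}
    {hs : Fin N → Z → ℝ}
    {z : Z} (r s : ℝ) (w : Fin N → ℝ) (hμ₁ : DifferentiableAt ℝ μ₁ z)
        (hμ₂ : DifferentiableAt ℝ μ₂ z)
    (hX : DifferentiableAt ℝ X z) (hY : DifferentiableAt ℝ Y z) (hh : DifferentiableAt ℝ h z)
    (hhs : ∀ i, DifferentiableAt ℝ (hs i) z) :
    DifferentiableAt ℝ (fun z => r * (μ₂ z (s • Y z) + μ₁ z (s • X z) - h z - ∑ i, hs i z * w i)) z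
        ∧ ∀ v,
    fderiv ℝ (fun z => r * (μ₂ z (s • Y z) + μ₁ z (s • X z) - h z - ∑ i, hs i z * w i)) z v =
      r * ((fderiv ℝ μ₂ z v (s • Y z) + μ₂ z (s • fderiv ℝ Y z v)) +
          (fderiv ℝ μ₁ z v (s • X z) + μ₁ z (s • fderiv ℝ X z v))
        - fderiv ℝ h z v - ∑ i, fderiv ℝ (hs i) z v * w i) := by
  have h1 := hμ₁.hasFDerivAt.clm_apply (hX.hasFDerivAt.const_smul s)
  have h2 := hμ₂.hasFDerivAt.clm_apply (hY.hasFDerivAt.const_smul s)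
  have h3 := HasFDerivAt.fun_sum (u := Finset.univ) fun i _ => (hhs i).hasFDerivAt.mul_const (w i)
  have h4 := (((h2.fun_add h1).fun_sub hh.hasFDerivAt).fun_sub h3).const_mul r
  refine ⟨h4.differentiableAt, fun v => ?_⟩
  refine (congrArg (fun L : Z →L[ℝ] ℝ => L v) h4.fderiv).trans ?_
  simp [mul_comm, add_comm]

namespace SchemeData

variable {K N : ℕ} (D : SchemeData E G K N)

/-- The variables interior to one step contribute nothing, since their equations hold; only the
variations of the two nodes `g_k`, `g_{k+1}` survive. -/
lemma fderiv_action_summand (hH : ContMDiff (cotangentModel E) 𝓘(ℝ, ℝ) ∞ D.H)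
    (hHs : ∀ i, ContMDiff (cotangentModel E) 𝓘(ℝ, ℝ) ∞ (D.Hs i)) (hdt : D.dt ≠ 0)
    {c : Z → DiscreteCurve E G K} {z : Z}
    (hg : ∀ k, MDifferentiableAt 𝓘(ℝ, Z) 𝓘(ℝ, E) (fun z => (c z).g k) z)
    (hgt : ∀ k, MDifferentiableAt 𝓘(ℝ, Z) 𝓘(ℝ, E) (fun z => (c z).gt k) z)
    (hmu1 : ∀ k, DifferentiableAt ℝ (fun z => (c z).mu1 k) z)
    (hmu2 : ∀ k, DifferentiableAt ℝ (fun z => (c z).mu2 k) z)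
    (hs : D.Solves (c z)) (k : Fin K) :
    DifferentiableAt ℝ (fun z => D.dt * ((c z).mu2 k (D.xi (c z) k) + (c z).mu1 k
        (D.xiTilde (c z) k)
      - trivHam D.H ((c z).gt k, muMid (c z) k)
      - ∑ i : Fin N, trivHam (D.Hs i) ((c z).gt k, muMid (c z) k) * (D.dW k i / D.dt))) z ∧ ∀ v,
    fderiv ℝ (fun z => D.dt * ((c z).mu2 k (D.xi (c z) k) + (c z).mu1 k (D.xiTilde (c z) k)
      - trivHam D.H ((c z).gt k, muMid (c z) k)
      - ∑ i : Fin N, trivHam (D.Hs i) ((c z).gt k, muMid (c z) k) * (D.dW k i / D.dt))) z v =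
    coAd (((c z).gt k)⁻¹ * (c z).g k.succ)
        (D.τ.dInvDual (D.τ.invFun (((c z).gt k)⁻¹ * (c z).g k.succ)) ((c z).mu2 k))
        (maurerCartan (fun z => (c z).g k.succ) v z)
      - D.τ.dInvDual (D.τ.invFun (((c z).g k.castSucc)⁻¹ * (c z).gt k)) ((c z).mu1 k)
        (maurerCartan (fun z => (c z).g k.castSucc) v z) := by
  obtain ⟨ha1, ha2⟩ := hs.admissible k
  obtain ⟨dX, fX⟩ := D.τ.hasFDerivAt_invFun (hg k.castSucc) (hgt k) ha1
  obtain ⟨dY, fY⟩ := D.τ.hasFDerivAt_invFun (hgt k) (hg k.succ) ha2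
  have hmid : DifferentiableAt ℝ (fun z => muMid (c z) k) z := ((hmu1 k).add (hmu2 k)).const_smul
      (1 / 2 : ℝ)
  have fmid : ∀ v, fderiv ℝ (fun z => muMid (c z) k) z v = (1 / 2 : ℝ) •
      (fderiv ℝ (fun z => (c z).mu1 k) z v + fderiv ℝ (fun z => (c z).mu2 k) z v) := fun v =>
    congrArg (fun L : Z →L[ℝ] E →L[ℝ] ℝ => L v)
        (((hmu1 k).hasFDerivAt.add (hmu2 k).hasFDerivAt).const_smul (1 / 2 : ℝ)).fderiv
  obtain ⟨dh, fh⟩ := fderiv_trivHam hH (hgt k) hmid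
  have hhs := fun i => fderiv_trivHam (hHs i) (hgt k) hmid
  obtain ⟨d, f⟩ := fderiv_action_term D.dt D.dt⁻¹ (fun i => D.dW k i / D.dt) (hmu1 k) (hmu2 k) dX dY
      dh (fun i => (hhs i).1)
  refine ⟨d, fun v => (f v).trans ?_⟩
  -- The velocity equations are tested on the actual variations of the momenta; the `½` in
  -- `velocity` matches the `½` in the derivative of `muMid`.
  have e1 := hs.eq_mu1 k (fderiv ℝ (fun z => (c z).mu1 k) z v)
  have e2 := hs.eq_mu2 k (fderiv ℝ (fun z => (c z).mu2 k) z v)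
  have e3 := congrArg (fun L : E →L[ℝ] ℝ => D.dt * L (maurerCartan (fun z => (c z).gt k) v z))
      (hs.eq_gt k)
  simp only [xiTilde, xi, velocity] at e1 e2 e3
  -- The time step cancels in `Δt ξ`, and `τ (Δt ξ̃)` is the group increment itself, so `Ad` is
  -- taken at the same element as in `fX`.
  rw [smul_inv_smul₀ hdt, smul_inv_smul₀ hdt, D.τ.toFun_invFun ha1] at e3
  rw [e1, e2, fX, fY, fh]
  simp only [(hhs _).2, fmid]
  simp only [smul_apply, sub_apply, add_apply,
    sum_apply, smul_eq_mul, mul_inv_cancel_left₀ hdt] at e3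
  simp only [smul_apply, add_apply, map_smul, map_add, map_sub,
    sum_apply, smul_eq_mul, add_mul, mul_add, mul_sub, Finset.sum_add_distrib,
    mul_inv_cancel_left₀ hdt, Finset.mul_sum]
  simp only [coAd, RetractionMap.dInvDual, ContinuousLinearMap.comp_apply, mul_add,
      Finset.mul_sum] at e3 ⊢
  linear_combination (norm := skip) e3
  simp only [mul_comm, mul_left_comm]
  ring

/-- The first variation of the discrete action at a solution of the scheme consists of boundary
terms. -/
lemma fderiv_action [NeZero K] (hH : ContMDiff (cotangentModel E) 𝓘(ℝ, ℝ) ∞ D.H)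
    (hHs : ∀ i, ContMDiff (cotangentModel E) 𝓘(ℝ, ℝ) ∞ (D.Hs i)) (hdt : D.dt ≠ 0)
    {c : Z → DiscreteCurve E G K} {z : Z}
    (hg : ∀ k, MDifferentiableAt 𝓘(ℝ, Z) 𝓘(ℝ, E) (fun z => (c z).g k) z)
    (hgt : ∀ k, MDifferentiableAt 𝓘(ℝ, Z) 𝓘(ℝ, E) (fun z => (c z).gt k) z)
    (hmu1 : ∀ k, DifferentiableAt ℝ (fun z => (c z).mu1 k) z)
    (hmu2 : ∀ k, DifferentiableAt ℝ (fun z => (c z).mu2 k) z)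
    (hs : D.Solves (c z)) (v : Z) :
    fderiv ℝ (fun z => D.action (c z)) z v =
    coAd (((c z).gt (Fin.rev 0))⁻¹ * (c z).g (Fin.last K))
        (D.τ.dInvDual (D.τ.invFun (((c z).gt (Fin.rev 0))⁻¹ * (c z).g (Fin.last K)))
            ((c z).mu2 (Fin.rev 0)))
        (maurerCartan (fun z => (c z).g (Fin.last K)) v z)
      - D.τ.dInvDual (D.τ.invFun (((c z).g 0)⁻¹ * (c z).gt 0)) ((c z).mu1 0)
        (maurerCartan (fun z => (c z).g 0) v z) := by
  have h := fun k => D.fderiv_action_summand hH hHs hdt hg hgt hmu1 hmu2 hs k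
  have hsum := HasFDerivAt.fun_sum (u := Finset.univ) fun k _ => (h k).1.hasFDerivAt
  refine (congrArg (fun L : Z →L[ℝ] ℝ => L v) hsum.fderiv).trans ?_
  simp only [sum_apply, (h _).2 v]
  have htel := sum_fin_sub_telescope (fun k : Fin K => coAd (((c z).gt k)⁻¹ * (c z).g k.succ)
        (D.τ.dInvDual (D.τ.invFun (((c z).gt k)⁻¹ * (c z).g k.succ)) ((c z).mu2 k))
        (maurerCartan (fun z => (c z).g k.succ) v z))
      (fun k => D.τ.dInvDual (D.τ.invFun (((c z).g k.castSucc)⁻¹ * (c z).gt k)) ((c z).mu1 k)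
        (maurerCartan (fun z => (c z).g k.castSucc) v z)) ?_
  · have e1 : (Fin.rev 0 : Fin K).succ = Fin.last K := by
      obtain ⟨n, rfl⟩ := Nat.exists_eq_succ_of_ne_zero (NeZero.ne K)
      simp
    have e2 : (0 : Fin K).castSucc = 0 := by
      obtain ⟨n, rfl⟩ := Nat.exists_eq_succ_of_ne_zero (NeZero.ne K)
      simp
    simp only [e1, e2] at htel
    exact htel
  -- The node equation says that the right boundary momentum of one step is the left boundary
  -- momentum of the next.
  · intro k hk
    have e := hs.eq_g k hk
    rw [smul_eq_zero_iff_right (inv_ne_zero hdt), sub_eq_zero] at e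
    simp only [xi, xiTilde] at e
    rw [smul_inv_smul₀ hdt, smul_inv_smul₀ hdt, D.τ.toFun_invFun (hs.admissible _).2] at e
    exact congrArg (fun L : E →L[ℝ] ℝ => L (maurerCartan (fun z => (c z).g ⟨k + 1, by omega⟩) v z))
        e

end SchemeData

/-! ### Symplecticity of the two kinds of flow. -/

lemma liouville_trivInv {f : Z → CotangentBundle E G}
    {g : Z → G} {ν : Z → E →L[ℝ] ℝ} {z : Z} (h : ∀ᶠ z' in 𝓝 z, f z' = trivInv (g z', ν z')) (v : Z)
        :
    liouville f v z = ν z (maurerCartan g v z) := by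
  have h1 : (fun z => (f z).proj) =ᶠ[𝓝 z] g := h.mono fun z' h => congrArg TotalSpace.proj h
  have h2 : maurerCartan (E := E) (fun z => (f z).proj) v z = maurerCartan g v z :=
    congrArg₂ (fun (a : G) (L : Z →L[ℝ] E) => leftTInv a (L v)) h1.self_of_nhds h1.mfderiv_eq
  rw [liouville_eq_maurerCartan, h.self_of_nhds, triv_trivInv]
  exact congrArg (ν z) h2

namespace SchemeData

variable {K N : ℕ} (D : SchemeData E G K N)

/-- Admissibility at the one parameter `m` suffices because the domain of `τ⁻¹` is open. -/
lemma contMDiffAt_action (hH : ContMDiff (cotangentModel E) 𝓘(ℝ, ℝ) ∞ D.H)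
    (hHs : ∀ i, ContMDiff (cotangentModel E) 𝓘(ℝ, ℝ) ∞ (D.Hs i))
    {F : Type*} [NormedAddCommGroup F] [NormedSpace ℝ F]
    {B : Type*} [TopologicalSpace B] {I : ModelWithCorners ℝ F B}
    {M : Type*} [TopologicalSpace M] [ChartedSpace B M]
    {c : M → DiscreteCurve E G K} {V : Set M} (hc : SmoothFamilyOn I c V) {m : M} (hV : V ∈ 𝓝 m)
    (hs : D.Admissible (c m)) : ContMDiffAt I 𝓘(ℝ, ℝ) ∞ (fun m => D.action (c m)) m := by
  have hg := fun k => (hc.g k).contMDiffAt hV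
  have hgt := fun k => (hc.gt k).contMDiffAt hV
  have hmu1 := fun k => (hc.mu1 k).contMDiffAt hV
  have hmu2 := fun k => (hc.mu2 k).contMDiffAt hV
  have hxi : ∀ k, ContMDiffAt I 𝓘(ℝ, E) ∞ (fun m => D.xi (c m) k) m := fun k =>
    (contMDiffAt_const (I' := 𝓘(ℝ, ℝ))).smul (ContMDiffAt.comp m (g := D.τ.invFun)
        (D.τ.contMDiffAt_invFun (hs k).2) ((hgt k).inv.mul (hg k.succ)))
  have hxit : ∀ k, ContMDiffAt I 𝓘(ℝ, E) ∞ (fun m => D.xiTilde (c m) k) m := fun k =>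
    (contMDiffAt_const (I' := 𝓘(ℝ, ℝ))).smul (ContMDiffAt.comp m (g := D.τ.invFun)
        (D.τ.contMDiffAt_invFun (hs k).1) ((hg k.castSucc).inv.mul (hgt k)))
  have hmid : ∀ k, ContMDiffAt I 𝓘(ℝ, E →L[ℝ] ℝ) ∞ (fun m => muMid (c m) k) m := fun k =>
    (contMDiffAt_const (I' := 𝓘(ℝ, ℝ)) (c := (1 / 2 : ℝ))).smul ((hmu1 k).add (hmu2 k))
  have hh : ∀ {H : CotangentBundle E G → ℝ}, ContMDiff (cotangentModel E) 𝓘(ℝ, ℝ) ∞ H → ∀ k,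
      ContMDiffAt I 𝓘(ℝ, ℝ) ∞ (fun m => trivHam H ((c m).gt k, muMid (c m) k)) m := fun {H} hH k =>
    ContMDiffAt.comp m (g := trivHam H) (contMDiff_trivHam hH _) ((hgt k).prodMk (hmid k))
  refine contMDiffAt_finsetSum fun k _ => ?_
  refine contMDiffAt_const.mul ?_
  refine ((((hmu2 k).clm_apply (hxi k)).add ((hmu1 k).clm_apply (hxit k))).sub (hh hH k)).sub ?_
  exact contMDiffAt_finsetSum fun i _ => (hh (hHs i) k).mul contMDiffAt_const

lemma IsTypeIFlow.isSymplecticOn {D : SchemeData E G K N} (hH : ContMDiff (cotangentModel E) 𝓘(ℝ, ℝ)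
    ∞ D.H)
    (hHs : ∀ i, ContMDiff (cotangentModel E) 𝓘(ℝ, ℝ) ∞ (D.Hs i)) {U : Set (CotangentBundle E G)}
    {F : CotangentBundle E G → CotangentBundle E G} (h : D.IsTypeIFlow U F) : IsSymplecticOn F U
        := by
  intro x₀ hx₀
  obtain ⟨c, V, hc, hgen⟩ := h.generated x₀ hx₀
  have hS : ∀ z ∈ V, ContMDiffAt ((𝓘(ℝ, E)).prod 𝓘(ℝ, E)) 𝓘(ℝ, ℝ) ∞ (D.genFun c) z := fun z hz =>
    D.contMDiffAt_action hH hHs hc.smooth (hc.isOpen.mem_nhds hz) (hc.solves z hz).admissible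
  have hF : ∀ x ∈ U, ContMDiffAt (cotangentModel E) (cotangentModel E) ∞ F x := fun x hx =>
    h.smooth.contMDiffAt (h.isOpen.mem_nhds hx)
  have hFp : ∀ x ∈ U, ContMDiffAt (cotangentModel E) 𝓘(ℝ, E) ∞ (fun x => (F x).proj) x :=
      fun x hx =>
    (contMDiff_cotangent_proj (F x)).comp x (hF x hx)
  -- The primitive is the generating function pulled back by `x ↦ (g₀, g_K)`; no invertibility of
  -- this map is needed.
  refine canonicalForm_mfderiv_of_exact (S := fun x => D.genFun c (x.proj, (F x).proj)) (hF x₀ hx₀)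
    (ContMDiffAt.comp x₀ (g := D.genFun c) (hS _ hgen.self_of_nhds.1)
      ((contMDiff_cotangent_proj x₀).prodMk (hFp x₀ hx₀))) ?_
  filter_upwards [hgen, h.isOpen.mem_nhds hx₀] with x ⟨hxV, hx1, hx2⟩ hxU v
  have hd := (hS _ hxV).mdifferentiableAt (by simp)
  have hp := (contMDiff_cotangent_proj x).mdifferentiableAt (by simp)
  have hFd := (hFp x hxU).mdifferentiableAt (by simp)
  have h0 := mfderiv_comp_apply x (f := fun x : CotangentBundle E G => (x.proj, (F x).proj)) hd
      (hp.prodMk hFd) v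
  rw [mfderiv_prod_eq_add_apply hd] at h0
  have h2 := mfderiv_prodMk hp hFd
  have h3 : (mfderiv (cotangentModel E) ((𝓘(ℝ, E)).prod 𝓘(ℝ, E)) (fun x : CotangentBundle E G =>
      (x.proj, (F x).proj)) x v : E × E) =
      (mfderiv (cotangentModel E) 𝓘(ℝ, E) (fun x : CotangentBundle E G => x.proj) x v,
        mfderiv (cotangentModel E) 𝓘(ℝ, E) (fun x => (F x).proj) x v) :=
    congrArg (fun L : E × (E →L[ℝ] ℝ) →L[ℝ] E × E => L v) h2
  have hx1' := congrArg (fun L : E →L[ℝ] ℝ =>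
      L (mfderiv (cotangentModel E) 𝓘(ℝ, E) (fun x : CotangentBundle E G => x.proj) x v)) hx1
  have hx2' := congrArg (fun L : E →L[ℝ] ℝ =>
      L (mfderiv (cotangentModel E) 𝓘(ℝ, E) (fun x => (F x).proj) x v)) hx2
  refine Eq.trans ?_ h0.symm
  have e : ∀ a b a' b' : ℝ, b = -a' → a = b' → a - b = a' + b' := by
    intro a b a' b' h h'; rw [h, h']; ring
  refine e _ _ _ _ (hx1'.trans (congrArg Neg.neg ?_)) (hx2'.trans ?_)
  · exact congrArg (mfderiv 𝓘(ℝ, E) 𝓘(ℝ, ℝ) (fun a : G => D.genFun c (a, (F x).proj)) x.proj)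
      (congrArg Prod.fst h3).symm
  · exact congrArg (mfderiv 𝓘(ℝ, E) 𝓘(ℝ, ℝ) (fun b : G => D.genFun c (x.proj, b)) (F x).proj)
      (congrArg Prod.snd h3).symm

lemma IsMidpointFlow.isSymplecticOn [NeZero K] {D : SchemeData E G K N} (hdt : D.dt ≠ 0)
    (hH : ContMDiff (cotangentModel E) 𝓘(ℝ, ℝ) ∞ D.H)
    (hHs : ∀ i, ContMDiff (cotangentModel E) 𝓘(ℝ, ℝ) ∞ (D.Hs i)) {U : Set (CotangentBundle E G)}
    {F : CotangentBundle E G → CotangentBundle E G} (h : D.IsMidpointFlow U F) : IsSymplecticOn F U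
        := by
  intro x₀ hx₀
  obtain ⟨c, V, hV, hxV, hc, hgen⟩ := h.generated x₀ hx₀
  set e := extChartAt (cotangentModel E) x₀
  have hF : ContMDiffAt (cotangentModel E) (cotangentModel E) ∞ F x₀ := h.smooth.contMDiffAt
      (h.isOpen.mem_nhds hx₀)
  have hact : ContMDiffAt (cotangentModel E) 𝓘(ℝ, ℝ) ∞ (fun x => D.action (c x)) x₀ :=
    D.contMDiffAt_action hH hHs hc (hV.mem_nhds hxV) (hgen x₀ hxV).1.admissible
  have hx : x₀ ∈ (chartAt (ModelProd E (E →L[ℝ] ℝ)) x₀).source := mem_chart_source _ x₀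
  have hex : e.symm (e x₀) = x₀ := extChartAt_to_inv x₀
  have hs : ContMDiffAt 𝓘(ℝ, E × (E →L[ℝ] ℝ)) (cotangentModel E) ∞ e.symm (e x₀) :=
      contMDiffAt_extChartAt_symm' hx
  have hS : ContMDiffAt 𝓘(ℝ, E × (E →L[ℝ] ℝ)) 𝓘(ℝ, ℝ) ∞ (fun z => D.action (c (e.symm z))) (e x₀) :=
    ContMDiffAt.comp_of_eq (g := fun x => D.action (c x)) hact hs hex
  refine canonicalForm_mfderiv_of_exact_chart hF hS.contDiffAt ?_
  have hc' : Tendsto e.symm (𝓝 (e x₀)) (𝓝 x₀) := by simpa only [hex] using hs.continuousAt.tendsto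
  have hd : ∀ᶠ z in 𝓝 (e x₀), MDifferentiableAt 𝓘(ℝ, E × (E →L[ℝ] ℝ)) (cotangentModel E) e.symm z
      := by
    filter_upwards [(contMDiffAt_iff_contMDiffAt_nhds (n := 1) (by simp)).1 (hs.of_le (by simp))]
        with z h
    exact h.mdifferentiableAt (by simp)
  -- The iterated neighbourhood is needed because `liouville_trivInv` differentiates the base point,
  -- so the momentum formulas must hold around each nearby `z`.
  have hVe : ∀ᶠ z in 𝓝 (e x₀), ∀ᶠ z' in 𝓝 z, e.symm z' ∈ V :=
    eventually_eventually_nhds.2 (hc'.eventually_mem (hV.mem_nhds hxV))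
  filter_upwards [hVe, hd] with z hz hdz v
  have hzV : V ∈ 𝓝 (e.symm z) := hV.mem_nhds hz.self_of_nhds
  rw [liouville_trivInv (f := F ∘ e.symm) (hz.mono fun z' hz' => (hgen _ hz').2.2) v,
      liouville_trivInv (f := e.symm) (hz.mono fun z' hz' => (hgen _ hz').2.1) v]
  -- The two Liouville pullbacks are now literally the boundary terms of the first variation.
  refine (D.fderiv_action hH hHs hdt (c := fun z => c (e.symm z)) (fun k => ?_) (fun k => ?_)
      (fun k => ?_) (fun k => ?_) (hgen _ hz.self_of_nhds).1 v).symm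
  · exact (((hc.g k).contMDiffAt hzV).mdifferentiableAt (by simp)).comp z hdz
  · exact (((hc.gt k).contMDiffAt hzV).mdifferentiableAt (by simp)).comp z hdz
  · exact ((((hc.mu1 k).contMDiffAt hzV).mdifferentiableAt (by simp)).comp z hdz).differentiableAt
  · exact ((((hc.mu2 k).contMDiffAt hzV).mdifferentiableAt (by simp)).comp z hdz).differentiableAt

end SchemeData

end LieMidpoint

end

theorem proposition3p4
    {E : Type*} [NormedAddCommGroup E] [NormedSpace ℝ E] [FiniteDimensional ℝ E]
    {G : Type*} [TopologicalSpace G] [ChartedSpace E G] [Group G] [LieGroup 𝓘(ℝ, E) ∞ G]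
    {K N : ℕ} [NeZero K] (T : ℝ) (hT : 0 < T)
    (H : LieMidpoint.CotangentBundle E G → ℝ)
    (hH : ContMDiff (LieMidpoint.cotangentModel E) 𝓘(ℝ, ℝ) ∞ H)
    (Hs : Fin N → LieMidpoint.CotangentBundle E G → ℝ)
    (hHs : ∀ i, ContMDiff (LieMidpoint.cotangentModel E) 𝓘(ℝ, ℝ) ∞ (Hs i))
    (τ : LieMidpoint.RetractionMap E G)
    {Ω : Type*} [MeasurableSpace Ω] (P : Measure Ω) [IsProbabilityMeasure P]
    (W : Fin N → ℝ → Ω → ℝ)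
    (U : Ω → Set (LieMidpoint.CotangentBundle E G))
    (F : Ω → LieMidpoint.CotangentBundle E G → LieMidpoint.CotangentBundle E G) :
    ((∀ᵐ s ∂P, (LieMidpoint.schemeAt H Hs τ T K W s).IsTypeIFlow (U s) (F s)) →
      ∀ᵐ s ∂P, LieMidpoint.IsSymplecticOn (F s) (U s) ∧
        LieMidpoint.IsTrivSymplecticOn
          (LieMidpoint.triv ∘ F s ∘ LieMidpoint.trivInv) (LieMidpoint.trivInv ⁻¹' U s)) ∧
    ((∀ᵐ s ∂P, (LieMidpoint.schemeAt H Hs τ T K W s).IsMidpointFlow (U s) (F s)) →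
      ∀ᵐ s ∂P, LieMidpoint.IsSymplecticOn (F s) (U s) ∧
        LieMidpoint.IsTrivSymplecticOn
          (LieMidpoint.triv ∘ F s ∘ LieMidpoint.trivInv) (LieMidpoint.trivInv ⁻¹' U s)) ∧
    (∀ (x : LieMidpoint.CotangentBundle E G) (v w : TangentSpace (LieMidpoint.cotangentModel E) x),
      LieMidpoint.trivForm (LieMidpoint.triv x)
        (mfderiv (LieMidpoint.cotangentModel E) (LieMidpoint.cotangentModel E)
          LieMidpoint.triv x v)
        (mfderiv (LieMidpoint.cotangentModel E) (LieMidpoint.cotangentModel E)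
          LieMidpoint.triv x w) = LieMidpoint.canonicalForm x v w) := by
  have hdt : T / (K : ℝ) ≠ 0 := (div_pos hT (Nat.cast_pos.2 (NeZero.pos K))).ne'
  refine ⟨fun h => ?_, fun h => ?_, LieMidpoint.trivForm_mfderiv_triv⟩
  -- For a fixed sample the increments of `W` are just real numbers, so the deterministic result
  -- applies pathwise.
  · filter_upwards [h] with s hs
    have hsymp := hs.isSymplecticOn hH hHs
    exact ⟨hsymp, hsymp.trivialized hs.isOpen hs.smooth⟩
  · filter_upwards [h] with s hs
    have hsymp := hs.isSymplecticOn hdt hH hHs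
    exact ⟨hsymp, hsymp.trivialized hs.isOpen hs.smooth⟩
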